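/- **Setting.** Let $\mathcal T$ be a finite double groupoid with set of boxes $\mathcal B$, horizontal arrows $\mathcal H$, vertical arrows $\mathcal V$ and points $\mathcal P$. For $A\in\mathcal B$ let $t(A),b(A)\in\mathcal H$ be its top and bottom sides, $l(A),r(A)\in\mathcal V$ its left and right sides, $lt(A),rt(A),lb(A),rb(A)\in\mathcal P$ its left top, right top, left bottom and right bottom vertices, and $A^{-1}$ its total (horizontal and vertical) inverse. Horizontal composition is written $XY$ and is defined when $r(X)=l(Y)$; vertical composition $\genfrac{}{}{0pt}{}{A}{B}$ is defined when $b(A)=t(B)$. Let $\Bbbk$ be a field of characteristic $0$ and let $\vartheta:\mathcal P\to\Bbbk^\times$ satisfy $$\sum_{U\in\mathcal B:\ t(U)=x,\ r(U)=g}\vartheta(lb(U))=1\qquad\text{for all } g\in\mathcal V,\ x\in\mathcal H \text{ such that the top end of } g \text{ is the right end of } x.$$ Let $\Bbbk^{(\vartheta)}\mathcal T$ be the $\Bbbk$-vector space with basis $\mathcal B$ and with * product $A.B=\genfrac{}{}{0pt}{}{A}{B}$ if $b(A)=t(B)$ and $A.B=0$ otherwise, and unit the sum of all vertical identities $\mathrm{id}\,x$,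 $x\in\mathcal H$; * coproduct $\Delta(A)=\sum_{XY=A}\vartheta(lb(Y))\,X\otimes Y$, and counit $\varepsilon(A)=\vartheta(lb(A))^{-1}$ if $A$ is a horizontal identity and $\varepsilon(A)=0$ otherwise; * antipode $\mathcal S(A)=\dfrac{\vartheta(rt(A))}{\vartheta(rb(A))}\,A^{-1}$. Let $\mathcal T^t$ be the transpose double groupoid, obtained from $\mathcal T$ by interchanging "horizontal" and "vertical" throughout; for a box $A$ of either double groupoid let $A^t$ be the same box regarded in the other one. Let $\Bbbk^{(\vartheta)}\mathcal T^t$ be the same construction applied to $\mathcal T^t$ and $\vartheta$. For $A\in\mathcal B$ put $\underline A=\vartheta(lb(A))\,A\in\Bbbk^{(\vartheta)}\mathcal T$ and $\mu(A)=\vartheta(lt(A))/\vartheta(rt(A))$. **Proposition.** $\Bbbk^{(\vartheta)}\mathcal T$ and $\Bbbk^{(\vartheta)}\mathcal T^t$ are weak Hopf algebras with the antipodes above; the dual space $(\Bbbk^{(\vartheta)}\mathcal T)^*$, with the transposed structure maps, is a weak Hopf algebra; and $$(\Bbbk^{(\vartheta)}\mathcal T)^*\simeq\Bbbk^{(\vartheta)}\mathcal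 T^t\quad\text{as weak Hopf algebras.}$$ More precisely, the bilinear form $(\ ,\ ):\Bbbk^{(\vartheta)}\mathcal T\times\Bbbk^{(\vartheta)}\mathcal T^t\to\Bbbk$ determined by $$(\underline A,B)=\mu(A)\,\delta_{A,B^t}\qquad(A \text{ a box of }\mathcal T,\ B \text{ a box of }\mathcal T^t)$$ is a nondegenerate weak Hopf algebra pairing: for all $a,a'\in\Bbbk^{(\vartheta)}\mathcal T$ and $x,x'\in\Bbbk^{(\vartheta)}\mathcal T^t$ one has $(aa',x)=(a\otimes a',\Delta(x))$, $(a,xx')=(\Delta(a),x\otimes x')$, $(1,x)=\varepsilon(x)$, $(a,1)=\varepsilon(a)$ and $(\mathcal S(a),x)=(a,\mathcal S(x))$. There is an isomorphism $e:(\Bbbk^{(\vartheta)}\mathcal T)^*\to\Bbbk^{(\vartheta)}\mathcal T^t$ of algebras and coalgebras which commutes with the antipodes and satisfies $f(a)=(a,e(f))$ for all $f\in(\Bbbk^{(\vartheta)}\mathcal T)^*$ and $a\in\Bbbk^{(\vartheta)}\mathcal T$. -/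

import Mathlib

open scoped TensorProduct

/-- A groupoid with set of arrows `G` and base `P`, given by its structure maps.
Composition is written from left to right: `comp f g` is defined when `tgt f = src g`. -/
structure GroupoidOn (G P : Type*) where
  src : G → P
  tgt : G → P
  id : P → G
  inv : G → G
  comp : ∀ f g : G, tgt f = src g → G
  src_id : ∀ p, src (id p) = p
  tgt_id : ∀ p, tgt (id p) = p
  src_inv : ∀ f, src (inv f) = tgt f
  tgt_inv : ∀ f, tgt (inv f) = src f
  src_comp : ∀ f g h, src (comp f g h) = src f
  tgt_comp : ∀ f g h, tgt (comp f g h) = tgt g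
  id_comp : ∀ f, comp (id (src f)) f (tgt_id _) = f
  comp_id : ∀ f, comp f (id (tgt f)) (src_id _).symm = f
  inv_comp : ∀ f, comp (inv f) f (tgt_inv f) = id (tgt f)
  comp_inv : ∀ f, comp f (inv f) (src_inv f).symm = id (src f)
  assoc : ∀ f g k (h₁ : tgt f = src g) (h₂ : tgt g = src k),
    comp (comp f g h₁) k ((tgt_comp f g h₁).trans h₂) =
      comp f (comp g k h₂) (h₁.trans (src_comp g k h₂).symm)

/-- A double groupoid with boxes `B`, horizontal arrows `H`, vertical arrows `V` and points `P`. -/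
structure DoubleGroupoid (B H V P : Type*) where
  /-- horizontal arrows: source is the left end, target is the right end -/
  gH : GroupoidOn H P
  /-- vertical arrows: source is the top end, target is the bottom end -/
  gV : GroupoidOn V P
  /-- vertical composition of boxes: source is the top side, target is the bottom side -/
  vB : GroupoidOn B H
  /-- horizontal composition of boxes: source is the left side, target is the right side -/
  hB : GroupoidOn B V
  corner_lt : ∀ A, gH.src (vB.src A) = gV.src (hB.src A)
  corner_rt : ∀ A, gH.tgt (vB.src A) = gV.src (hB.tgt A)
  corner_lb : ∀ A, gH.src (vB.tgt A) = gV.tgt (hB.src A)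
  corner_rb : ∀ A, gH.tgt (vB.tgt A) = gV.tgt (hB.tgt A)
  top_hcomp : ∀ A C (h : hB.tgt A = hB.src C), vB.src (hB.comp A C h) =
    gH.comp (vB.src A) (vB.src C) (by rw [corner_rt, corner_lt, h])
  bot_hcomp : ∀ A C (h : hB.tgt A = hB.src C), vB.tgt (hB.comp A C h) =
    gH.comp (vB.tgt A) (vB.tgt C) (by rw [corner_rb, corner_lb, h])
  left_vcomp : ∀ A C (h : vB.tgt A = vB.src C), hB.src (vB.comp A C h) =
    gV.comp (hB.src A) (hB.src C) (by rw [← corner_lb, ← corner_lt, h])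
  right_vcomp : ∀ A C (h : vB.tgt A = vB.src C), hB.tgt (vB.comp A C h) =
    gV.comp (hB.tgt A) (hB.tgt C) (by rw [← corner_rb, ← corner_rt, h])
  top_hid : ∀ g, vB.src (hB.id g) = gH.id (gV.src g)
  bot_hid : ∀ g, vB.tgt (hB.id g) = gH.id (gV.tgt g)
  left_vid : ∀ x, hB.src (vB.id x) = gV.id (gH.src x)
  right_vid : ∀ x, hB.tgt (vB.id x) = gV.id (gH.tgt x)
  vid_comp : ∀ x y (h : gH.tgt x = gH.src y), vB.id (gH.comp x y h) =
    hB.comp (vB.id x) (vB.id y) (by rw [right_vid, left_vid, h])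
  hid_comp : ∀ f g (h : gV.tgt f = gV.src g), hB.id (gV.comp f g h) =
    vB.comp (hB.id f) (hB.id g) (by rw [bot_hid, top_hid, h])
  vid_id : ∀ p, vB.id (gH.id p) = hB.id (gV.id p)
  interchange : ∀ A C D E (hAC : hB.tgt A = hB.src C) (hDE : hB.tgt D = hB.src E)
      (hAD : vB.tgt A = vB.src D) (hCE : vB.tgt C = vB.src E),
    vB.comp (hB.comp A C hAC) (hB.comp D E hDE)
        (by simp only [bot_hcomp, top_hcomp, hAD, hCE]) =
      hB.comp (vB.comp A D hAD) (vB.comp C E hCE)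
        (by simp only [left_vcomp, right_vcomp, hAC, hDE])

section WeakHopf

variable (k H : Type*) [Field k] [Ring H] [Algebra k H] [Coalgebra k H]

open Coalgebra LinearMap in
/-- A weak bialgebra: an algebra and coalgebra `H` such that `Δ(ab) = Δ(a)Δ(b)`,
`Δ²(1) = (Δ(1) ⊗ 1)(1 ⊗ Δ(1)) = (1 ⊗ Δ(1))(Δ(1) ⊗ 1)` and
`ε(abc) = ε(ab₁)ε(b₂c) = ε(ab₂)ε(b₁c)`. -/
structure IsWeakBialgebra : Prop where
  comul_mul : ∀ a b : H, comul (R := k) (a * b) = comul (R := k) a * comul (R := k) b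
  comul_comul_one : lTensor H (comul (R := k)) (comul (R := k) (1 : H)) =
    TensorProduct.assoc k H H H (comul (R := k) (1 : H) ⊗ₜ[k] (1 : H)) *
      ((1 : H) ⊗ₜ[k] comul (R := k) (1 : H))
  comul_comul_one' : lTensor H (comul (R := k)) (comul (R := k) (1 : H)) =
    ((1 : H) ⊗ₜ[k] comul (R := k) (1 : H)) *
      TensorProduct.assoc k H H H (comul (R := k) (1 : H) ⊗ₜ[k] (1 : H))
  counit_mul_mul : ∀ a b c : H, counit (R := k) (a * b * c) =
    mul' k k (TensorProduct.map (counit (R := k) ∘ₗ mulLeft k a) (counit (R := k) ∘ₗ mulRight k c)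
      (comul (R := k) b))
  counit_mul_mul' : ∀ a b c : H, counit (R := k) (a * b * c) =
    mul' k k (TensorProduct.map (counit (R := k) ∘ₗ mulLeft k a) (counit (R := k) ∘ₗ mulRight k c)
      (TensorProduct.comm k H H (comul (R := k) b)))

variable {H}

/-- The source map `ε_s(h) = (id ⊗ ε)((1 ⊗ h) Δ(1))`. -/
noncomputable def weakSource (h : H) : H :=
  TensorProduct.rid k H (LinearMap.lTensor H (Coalgebra.counit (R := k))
    (((1 : H) ⊗ₜ[k] h) * Coalgebra.comul (R := k) (1 : H)))

/-- The target map `ε_t(h) = (ε ⊗ id)(Δ(1) (h ⊗ 1))`. -/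
noncomputable def weakTarget (h : H) : H :=
  TensorProduct.lid k H (LinearMap.rTensor H (Coalgebra.counit (R := k))
    (Coalgebra.comul (R := k) (1 : H) * (h ⊗ₜ[k] (1 : H))))

open Coalgebra LinearMap in
/-- `H` is a weak Hopf algebra with antipode `S`: it is a weak bialgebra, `m(id ⊗ S)Δ = ε_t`,
`m(S ⊗ id)Δ = ε_s` and `m²(S ⊗ id ⊗ S)Δ² = S`. -/
structure IsWeakHopfAlgebra (S : H →ₗ[k] H) : Prop extends IsWeakBialgebra k H where
  mul_id_antipode : ∀ h : H, mul' k H (lTensor H S (comul (R := k) h)) = weakTarget k h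
  mul_antipode_id : ∀ h : H, mul' k H (rTensor H S (comul (R := k) h)) = weakSource k h
  mul_antipode_id_antipode : ∀ h : H,
    mul' k H (TensorProduct.map S (mul' k H ∘ₗ lTensor H S)
      (lTensor H (comul (R := k)) (comul (R := k) h))) = S h

/-- A weak Hopf algebra pairing of `H` and `K`, with antipodes `S` and `S'`: the multiplication,
unit, and antipode of either side are adjoint to the comultiplication, counit, and antipode
of the other. -/
structure IsWeakHopfPairing {K : Type*} [Ring K] [Algebra k K] [Coalgebra k K]
    (S : H →ₗ[k] H) (S' : K →ₗ[k] K) (β : H →ₗ[k] K →ₗ[k] k) : Prop where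
  mul_left : ∀ (a b : H) (x : K), β (a * b) x =
    LinearMap.mul' k k (TensorProduct.map (β a) (β b) (Coalgebra.comul (R := k) x))
  mul_right : ∀ (a : H) (x y : K), β a (x * y) =
    LinearMap.mul' k k (TensorProduct.map (β.flip x) (β.flip y) (Coalgebra.comul (R := k) a))
  one_left : ∀ x : K, β 1 x = Coalgebra.counit (R := k) x
  one_right : ∀ a : H, β a 1 = Coalgebra.counit (R := k) a
  antipode : ∀ (a : H) (x : K), β (S a) x = β a (S' x)

end WeakHopf

section Dual

variable (k H : Type*) [Field k]

/-- The dual space of a finite-dimensional algebra and coalgebra `H`. Its algebra structure is the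
convolution product `(fg)(a) = f(a₁)g(a₂)` of Mathlib, with unit the counit of `H`. -/
abbrev DualAlg [AddCommGroup H] [Module k H] : Type _ := WithConv (Module.Dual k H)

variable [Ring H] [Algebra k H] [Module.Finite k H]

/-- The identification of `H* ⊗ H*` with `(H ⊗ H)*`, `(f ⊗ g)(a ⊗ b) = f(a)g(b)`. -/
noncomputable def dualTensorEquiv :
    DualAlg k H ⊗[k] DualAlg k H ≃ₗ[k] Module.Dual k (H ⊗[k] H) :=
  (TensorProduct.congr (WithConv.linearEquiv k (Module.Dual k H))
    (WithConv.linearEquiv k (Module.Dual k H))).trans (TensorProduct.dualDistribEquiv k H H)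

theorem dualTensorEquiv_tmul (f g : DualAlg k H) (a b : H) :
    dualTensorEquiv k H (f ⊗ₜ[k] g) (a ⊗ₜ[k] b) = f a * g b := by
  simp [dualTensorEquiv]

/-- The comultiplication of the dual: `Δ(f)` is the functional `a ⊗ b ↦ f(ab)`. -/
noncomputable def dualComul : DualAlg k H →ₗ[k] DualAlg k H ⊗[k] DualAlg k H :=
  (dualTensorEquiv k H).symm.toLinearMap ∘ₗ (LinearMap.mul' k H).dualMap ∘ₗ
    (WithConv.linearEquiv k (Module.Dual k H)).toLinearMap

/-- The counit of the dual: `ε(f) = f(1)`. -/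
noncomputable def dualCounit : DualAlg k H →ₗ[k] k :=
  LinearMap.applyₗ (1 : H) ∘ₗ (WithConv.linearEquiv k (Module.Dual k H)).toLinearMap

theorem dualTensorEquiv_dualComul (f : DualAlg k H) (a b : H) :
    dualTensorEquiv k H (dualComul k H f) (a ⊗ₜ[k] b) = f (a * b) := by
  simp [dualComul]

theorem dualComul_coassoc (f : DualAlg k H) :
    TensorProduct.assoc k _ _ _ (LinearMap.rTensor _ (dualComul k H) (dualComul k H f)) =
      LinearMap.lTensor _ (dualComul k H) (dualComul k H f) := by
  let t : DualAlg k H ⊗[k] (DualAlg k H ⊗[k] DualAlg k H) ≃ₗ[k] Module.Dual k (H ⊗[k] (H ⊗[k] H)) :=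
    (TensorProduct.congr (WithConv.linearEquiv k (Module.Dual k H)) (dualTensorEquiv k H)).trans
      (TensorProduct.dualDistribEquiv k H (H ⊗[k] H))
  have ht : ∀ f w a z, t (f ⊗ₜ w) (a ⊗ₜ z) = f a * dualTensorEquiv k H w z := by
    intro f w a z; simp [t]
  have h₁ : ∀ w a b c, t (LinearMap.lTensor _ (dualComul k H) w) (a ⊗ₜ (b ⊗ₜ c)) =
      dualTensorEquiv k H w (a ⊗ₜ (b * c)) := by
    intro w a b c
    induction w with
    | zero => simp
    | add x y hx hy => simp only [map_add, LinearMap.add_apply, hx, hy]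
    | tmul f g =>
      rw [LinearMap.lTensor_tmul, ht, dualTensorEquiv_dualComul, dualTensorEquiv_tmul]
  have h₂ : ∀ w g a b c, t (TensorProduct.assoc k _ _ _ (w ⊗ₜ g)) (a ⊗ₜ (b ⊗ₜ c)) =
      dualTensorEquiv k H w (a ⊗ₜ b) * g c := by
    intro w g a b c
    induction w with
    | zero => simp
    | add x y hx hy => simp only [TensorProduct.add_tmul, map_add, LinearMap.add_apply, hx, hy, add_mul]
    | tmul f e =>
      rw [TensorProduct.assoc_tmul, ht, dualTensorEquiv_tmul, dualTensorEquiv_tmul, mul_assoc]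
  have h₃ : ∀ w a b c, t (TensorProduct.assoc k _ _ _ (LinearMap.rTensor _ (dualComul k H) w))
      (a ⊗ₜ (b ⊗ₜ c)) = dualTensorEquiv k H w ((a * b) ⊗ₜ c) := by
    intro w a b c
    induction w with
    | zero => simp
    | add x y hx hy => simp only [map_add, LinearMap.add_apply, hx, hy]
    | tmul f g =>
      rw [LinearMap.rTensor_tmul, h₂, dualTensorEquiv_dualComul, dualTensorEquiv_tmul]
  apply t.injective
  refine TensorProduct.ext_threefold' fun a b c => ?_
  rw [h₃, h₁, dualTensorEquiv_dualComul, dualTensorEquiv_dualComul, mul_assoc]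

theorem dualCounit_left (f : DualAlg k H) :
    LinearMap.rTensor _ (dualCounit k H) (dualComul k H f) = (1 : k) ⊗ₜ[k] f := by
  have h : ∀ w (a : H), (TensorProduct.lid k _ (LinearMap.rTensor _ (dualCounit k H) w)) a =
      dualTensorEquiv k H w (1 ⊗ₜ a) := by
    intro w a
    induction w with
    | zero => simp
    | add x y hx hy => simp only [map_add, WithConv.ofConv_add, LinearMap.add_apply, hx, hy]
    | tmul f g => simp [dualTensorEquiv_tmul, dualCounit]
  apply (TensorProduct.lid k _).injective
  refine WithConv.ext (LinearMap.ext fun a => ?_)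
  rw [h, dualTensorEquiv_dualComul]
  simp

theorem dualCounit_right (f : DualAlg k H) :
    LinearMap.lTensor _ (dualCounit k H) (dualComul k H f) = f ⊗ₜ[k] (1 : k) := by
  have h : ∀ w (a : H), (TensorProduct.rid k _ (LinearMap.lTensor _ (dualCounit k H) w)) a =
      dualTensorEquiv k H w (a ⊗ₜ 1) := by
    intro w a
    induction w with
    | zero => simp
    | add x y hx hy => simp only [map_add, WithConv.ofConv_add, LinearMap.add_apply, hx, hy]
    | tmul f g => simp [dualTensorEquiv_tmul, dualCounit, mul_comm]
  apply (TensorProduct.rid k _).injective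
  refine WithConv.ext (LinearMap.ext fun a => ?_)
  rw [h, dualTensorEquiv_dualComul]
  simp

noncomputable instance : Coalgebra k (DualAlg k H) where
  comul := dualComul k H
  counit := dualCounit k H
  coassoc := LinearMap.ext fun f => dualComul_coassoc k H f
  rTensor_counit_comp_comul := LinearMap.ext fun f => dualCounit_left k H f
  lTensor_counit_comp_comul := LinearMap.ext fun f => dualCounit_right k H f

variable {k H}

/-- The antipode of the dual: `S*(f) = f ∘ S`. -/
noncomputable def dualAntipode (S : H →ₗ[k] H) : DualAlg k H →ₗ[k] DualAlg k H :=
  (WithConv.linearEquiv k (Module.Dual k H)).symm.toLinearMap ∘ₗ S.dualMap ∘ₗ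
    (WithConv.linearEquiv k (Module.Dual k H)).toLinearMap

end Dual

namespace DoubleGroupoid

variable {B H V P : Type*} (T : DoubleGroupoid B H V P)

/-- The top side `t(A)`. -/
def top (A : B) : H := T.vB.src A

/-- The bottom side `b(A)`. -/
def bot (A : B) : H := T.vB.tgt A

/-- The left side `l(A)`. -/
def left (A : B) : V := T.hB.src A

/-- The right side `r(A)`. -/
def right (A : B) : V := T.hB.tgt A

/-- The left top vertex. -/
def lt (A : B) : P := T.gH.src (T.top A)

/-- The right top vertex. -/
def rt (A : B) : P := T.gH.tgt (T.top A)

/-- The left bottom vertex. -/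
def lb (A : B) : P := T.gH.src (T.bot A)

/-- The right bottom vertex. -/
def rb (A : B) : P := T.gH.tgt (T.bot A)

/-- The total inverse `A⁻¹ = (Aʰ)ᵛ`. -/
def boxInv (A : B) : B := T.vB.inv (T.hB.inv A)

/-- The transpose double groupoid: 'horizontal' and 'vertical' are interchanged throughout.
It has the same boxes; the box `Aᵗ` of `T.transpose` is the element `A` of `B`. -/
def transpose : DoubleGroupoid B V H P where
  gH := T.gV
  gV := T.gH
  vB := T.hB
  hB := T.vB
  corner_lt A := (T.corner_lt A).symm
  corner_rt A := (T.corner_lb A).symm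
  corner_lb A := (T.corner_rt A).symm
  corner_rb A := (T.corner_rb A).symm
  top_hcomp := T.left_vcomp
  bot_hcomp := T.right_vcomp
  left_vcomp := T.top_hcomp
  right_vcomp := T.bot_hcomp
  top_hid := T.left_vid
  bot_hid := T.right_vid
  left_vid := T.top_hid
  right_vid := T.bot_hid
  vid_comp := T.hid_comp
  hid_comp := T.vid_comp
  vid_id p := (T.vid_id p).symm
  interchange A C D E h₁ h₂ h₃ h₄ := (T.interchange A D C E h₃ h₄ h₁ h₂).symm

/-- The set of pairs `(X, Y)` of horizontally composable boxes with `XY = A`. -/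
noncomputable def horFactorizations [Fintype B] (A : B) : Finset (B × B) :=
  open Classical in
  Finset.univ.filter fun p => ∃ h : T.hB.tgt p.1 = T.hB.src p.2, T.hB.comp p.1 p.2 h = A

section Algebra

variable (k : Type*) [Field k] (ϑ : P → kˣ)

/-- The normalization condition on `ϑ`: for all composable `(g, x)`, the sum of `ϑ(lb(U))` over
all boxes `U` with top side `x` and right side `g` equals `1`. -/
def IsCornerFunction [Fintype B] : Prop :=
  ∀ (g : V) (x : H), T.gV.src g = T.gH.tgt x →
    (open Classical in
      ∑ U ∈ Finset.univ.filter (fun U : B => T.top U = x ∧ T.right U = g), (ϑ (T.lb U) : k)) = 1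

/-- The underlying vector space of `k^(ϑ) T`: the `k`-vector space with basis the boxes. -/
def Alg (_T : DoubleGroupoid B H V P) (_ϑ : P → kˣ) : Type _ := B →₀ k

noncomputable instance : AddCommGroup (T.Alg k ϑ) := inferInstanceAs (AddCommGroup (B →₀ k))

noncomputable instance : Module k (T.Alg k ϑ) := inferInstanceAs (Module k (B →₀ k))

/-- The basis of boxes of `k^(ϑ) T`. -/
noncomputable def box : Module.Basis B k (T.Alg k ϑ) :=
  Module.Basis.ofRepr (LinearEquiv.refl k (B →₀ k))

instance [Fintype B] : Module.Finite k (T.Alg k ϑ) := Module.Finite.of_basis (T.box k ϑ)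

/-- The product of two boxes: their vertical composition if it is defined, and `0` otherwise. -/
noncomputable def boxMul (A C : B) : T.Alg k ϑ :=
  open Classical in
  if h : T.vB.tgt A = T.vB.src C then T.box k ϑ (T.vB.comp A C h) else 0

/-- The multiplication of `k^(ϑ) T`. -/
noncomputable def mulLin : T.Alg k ϑ →ₗ[k] T.Alg k ϑ →ₗ[k] T.Alg k ϑ :=
  (T.box k ϑ).constr k fun A => (T.box k ϑ).constr k fun C => T.boxMul k ϑ A C

noncomputable instance : Mul (T.Alg k ϑ) := ⟨fun a b => T.mulLin k ϑ a b⟩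

noncomputable instance [Fintype H] : One (T.Alg k ϑ) := ⟨∑ x : H, T.box k ϑ (T.vB.id x)⟩

theorem mul_def (a b : T.Alg k ϑ) : a * b = T.mulLin k ϑ a b := rfl

theorem one_def [Fintype H] : (1 : T.Alg k ϑ) = ∑ x : H, T.box k ϑ (T.vB.id x) := rfl

theorem box_mul_box (A C : B) : T.box k ϑ A * T.box k ϑ C = T.boxMul k ϑ A C := by
  simp [mul_def, mulLin]

theorem box_mul_of_eq (A C : B) (h : T.vB.tgt A = T.vB.src C) :
    T.box k ϑ A * T.box k ϑ C = T.box k ϑ (T.vB.comp A C h) := by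
  rw [box_mul_box, boxMul, dif_pos h]

theorem box_mul_of_ne (A C : B) (h : T.vB.tgt A ≠ T.vB.src C) :
    T.box k ϑ A * T.box k ϑ C = 0 := by
  rw [box_mul_box, boxMul, dif_neg h]

theorem box_mul_assoc (A C D : B) :
    T.box k ϑ A * T.box k ϑ C * T.box k ϑ D = T.box k ϑ A * (T.box k ϑ C * T.box k ϑ D) := by
  by_cases h₁ : T.vB.tgt A = T.vB.src C <;> by_cases h₂ : T.vB.tgt C = T.vB.src D
  · rw [T.box_mul_of_eq k ϑ _ _ h₁, T.box_mul_of_eq k ϑ _ _ h₂, T.box_mul_of_eq k ϑ _ _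
      ((T.vB.tgt_comp _ _ h₁).trans h₂), T.box_mul_of_eq k ϑ _ _
      (h₁.trans (T.vB.src_comp _ _ h₂).symm), T.vB.assoc _ _ _ h₁ h₂]
  · rw [T.box_mul_of_eq k ϑ _ _ h₁, T.box_mul_of_ne k ϑ _ _ h₂, T.box_mul_of_ne]
    · simp [mul_def]
    · rwa [T.vB.tgt_comp]
  · rw [T.box_mul_of_ne k ϑ _ _ h₁, T.box_mul_of_eq k ϑ _ _ h₂, T.box_mul_of_ne]
    · simp [mul_def]
    · rwa [T.vB.src_comp]
  · rw [T.box_mul_of_ne k ϑ _ _ h₁, T.box_mul_of_ne k ϑ _ _ h₂]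
    simp [mul_def]

theorem one_mul_box [Fintype H] (A : B) : 1 * T.box k ϑ A = T.box k ϑ A := by
  have e : (1 : T.Alg k ϑ) * T.box k ϑ A = ∑ x : H, T.box k ϑ (T.vB.id x) * T.box k ϑ A := by
    simp [mul_def, one_def]
  rw [e, Finset.sum_eq_single (T.vB.src A)]
  · rw [T.box_mul_of_eq k ϑ _ _ (T.vB.tgt_id _), T.vB.id_comp]
  · intro x _ hx
    exact T.box_mul_of_ne k ϑ _ _ (by rwa [T.vB.tgt_id])
  · simp

theorem box_mul_one [Fintype H] (A : B) : T.box k ϑ A * 1 = T.box k ϑ A := by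
  have e : T.box k ϑ A * (1 : T.Alg k ϑ) = ∑ x : H, T.box k ϑ A * T.box k ϑ (T.vB.id x) := by
    simp [mul_def, one_def]
  rw [e, Finset.sum_eq_single (T.vB.tgt A)]
  · rw [T.box_mul_of_eq k ϑ _ _ (T.vB.src_id _).symm, T.vB.comp_id]
  · intro x _ hx
    exact T.box_mul_of_ne k ϑ _ _ (by rw [T.vB.src_id]; exact Ne.symm hx)
  · simp

noncomputable instance [Fintype H] : Ring (T.Alg k ϑ) where
  __ := (inferInstance : AddCommGroup (T.Alg k ϑ))
  left_distrib a b c := by simp [mul_def]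
  right_distrib a b c := by simp [mul_def]
  zero_mul a := by simp [mul_def]
  mul_zero a := by simp [mul_def]
  mul_assoc a b c := by
    have : (T.mulLin k ϑ).compr₂ (T.mulLin k ϑ) =
        (LinearMap.lcomp k _ (T.mulLin k ϑ)) ∘ₗ (LinearMap.llcomp k _ _ _) ∘ₗ T.mulLin k ϑ := by
      refine (T.box k ϑ).ext fun A => (T.box k ϑ).ext fun C => (T.box k ϑ).ext fun D => ?_
      exact T.box_mul_assoc k ϑ A C D
    exact LinearMap.congr_fun (LinearMap.congr_fun (LinearMap.congr_fun this a) b) c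
  one_mul a := by
    have : T.mulLin k ϑ 1 = LinearMap.id := (T.box k ϑ).ext fun A => T.one_mul_box k ϑ A
    exact LinearMap.congr_fun this a
  mul_one a := by
    have : (T.mulLin k ϑ).flip 1 = LinearMap.id := (T.box k ϑ).ext fun A => T.box_mul_one k ϑ A
    exact LinearMap.congr_fun this a

noncomputable instance [Fintype H] : Algebra k (T.Alg k ϑ) :=
  Algebra.ofModule (fun r a b => by simp [mul_def]) (fun r a b => by simp [mul_def])

/-- The comultiplication `Δ(A) = ∑_{XY = A} ϑ(lb(Y)) X ⊗ Y`. -/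
noncomputable def comulLin [Fintype B] : T.Alg k ϑ →ₗ[k] T.Alg k ϑ ⊗[k] T.Alg k ϑ :=
  (T.box k ϑ).constr k fun A => ∑ p ∈ T.horFactorizations A,
    (ϑ (T.lb p.2) : k) • (T.box k ϑ p.1 ⊗ₜ[k] T.box k ϑ p.2)

/-- The counit: `ε(A) = ϑ(lb(A))⁻¹` if `A` is a horizontal identity, and `ε(A) = 0` otherwise. -/
noncomputable def counitLin : T.Alg k ϑ →ₗ[k] k :=
  (T.box k ϑ).constr k fun A =>
    open Classical in if A = T.hB.id (T.left A) then (((ϑ (T.lb A))⁻¹ : kˣ) : k) else 0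

theorem comulLin_box [Fintype B] (A : B) : T.comulLin k ϑ (T.box k ϑ A) =
    ∑ p ∈ T.horFactorizations A, (ϑ (T.lb p.2) : k) • (T.box k ϑ p.1 ⊗ₜ[k] T.box k ϑ p.2) :=
  (T.box k ϑ).constr_basis k _ A

open Classical in
theorem counitLin_box (A : B) : T.counitLin k ϑ (T.box k ϑ A) =
    if A = T.hB.id (T.left A) then (((ϑ (T.lb A))⁻¹ : kˣ) : k) else 0 :=
  (T.box k ϑ).constr_basis k _ A

theorem mem_horFactorizations [Fintype B] {A : B} {p : B × B} : p ∈ T.horFactorizations A ↔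
    ∃ h : T.hB.tgt p.1 = T.hB.src p.2, T.hB.comp p.1 p.2 h = A := by
  simp [horFactorizations]

theorem lb_of_comp {X Y : B} (h : T.hB.tgt X = T.hB.src Y) :
    T.lb (T.hB.comp X Y h) = T.lb X := by
  simp only [lb, bot, T.bot_hcomp, T.gH.src_comp]

theorem coassoc_box [Fintype B] (A : B) :
    TensorProduct.assoc k _ _ _ (LinearMap.rTensor _ (T.comulLin k ϑ)
      (T.comulLin k ϑ (T.box k ϑ A))) =
    LinearMap.lTensor _ (T.comulLin k ϑ) (T.comulLin k ϑ (T.box k ϑ A)) := by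
  classical
  simp only [comulLin_box, map_sum, map_smul, LinearMap.rTensor_tmul, LinearMap.lTensor_tmul,
    TensorProduct.sum_tmul, TensorProduct.tmul_sum, Finset.smul_sum, ← TensorProduct.smul_tmul',
    TensorProduct.tmul_smul, TensorProduct.assoc_tmul, Finset.sum_sigma', smul_smul]
  refine Finset.sum_bij' (i := fun q _ => ⟨(q.2.1, if h : T.hB.tgt q.2.2 = T.hB.src q.1.2 then
      T.hB.comp q.2.2 q.1.2 h else q.2.2), (q.2.2, q.1.2)⟩)
    (j := fun q _ => ⟨(if h : T.hB.tgt q.1.1 = T.hB.src q.2.1 then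
      T.hB.comp q.1.1 q.2.1 h else q.1.1, q.2.2), (q.1.1, q.2.1)⟩) ?_ ?_ ?_ ?_ ?_
  · rintro ⟨⟨X, Y⟩, ⟨U, W⟩⟩ hq
    simp only [Finset.mem_sigma, mem_horFactorizations] at hq ⊢
    obtain ⟨⟨h₁, e₁⟩, ⟨h₂, e₂⟩⟩ := hq
    subst e₂
    have h₃ : T.hB.tgt W = T.hB.src Y := by rw [← h₁, T.hB.tgt_comp]
    simp only [h₃, dite_true]
    refine ⟨⟨h₂.trans (T.hB.src_comp _ _ h₃).symm, ?_⟩, trivial, trivial⟩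
    rw [← e₁, T.hB.assoc _ _ _ h₂ h₃]
  · rintro ⟨⟨X, Y⟩, ⟨U, W⟩⟩ hq
    simp only [Finset.mem_sigma, mem_horFactorizations] at hq ⊢
    obtain ⟨⟨h₁, e₁⟩, ⟨h₂, e₂⟩⟩ := hq
    subst e₂
    have h₃ : T.hB.tgt X = T.hB.src U := by rw [h₁, T.hB.src_comp]
    simp only [h₃, dite_true]
    refine ⟨⟨(T.hB.tgt_comp _ _ h₃).trans h₂, ?_⟩, trivial, trivial⟩
    rw [← e₁, T.hB.assoc _ _ _ h₃ h₂]
  · rintro ⟨⟨X, Y⟩, ⟨U, W⟩⟩ hq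
    simp only [Finset.mem_sigma, mem_horFactorizations] at hq
    obtain ⟨⟨h₁, e₁⟩, ⟨h₂, e₂⟩⟩ := hq
    subst e₂
    simp [h₂]
  · rintro ⟨⟨X, Y⟩, ⟨U, W⟩⟩ hq
    simp only [Finset.mem_sigma, mem_horFactorizations] at hq
    obtain ⟨⟨h₁, e₁⟩, ⟨h₂, e₂⟩⟩ := hq
    subst e₂
    simp [h₂]
  · rintro ⟨⟨X, Y⟩, ⟨U, W⟩⟩ hq
    simp only [Finset.mem_sigma, mem_horFactorizations] at hq
    obtain ⟨⟨h₁, e₁⟩, ⟨h₂, e₂⟩⟩ := hq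
    subst e₂
    have h₃ : T.hB.tgt W = T.hB.src Y := by rw [← h₁, T.hB.tgt_comp]
    simp only [h₃, dite_true, T.lb_of_comp]
    rw [mul_comm]

theorem counit_left_box [Fintype B] (A : B) :
    LinearMap.rTensor _ (T.counitLin k ϑ) (T.comulLin k ϑ (T.box k ϑ A)) =
      (1 : k) ⊗ₜ[k] T.box k ϑ A := by
  classical
  simp only [comulLin_box, map_sum, map_smul, LinearMap.rTensor_tmul, counitLin_box]
  rw [Finset.sum_eq_single (T.hB.id (T.hB.src A), A)]
  · have e : T.lb (T.hB.id (T.hB.src A)) = T.lb A := by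
      rw [← T.lb_of_comp (T.hB.tgt_id (T.hB.src A)), T.hB.id_comp]
    simp only [left, T.hB.src_id, if_true, e, TensorProduct.smul_tmul']
    simp
  · rintro ⟨X, Y⟩ hp hne
    obtain ⟨h, e⟩ := T.mem_horFactorizations.1 hp
    simp only at h e hne ⊢
    rw [if_neg, TensorProduct.zero_tmul, smul_zero]
    intro hX
    apply hne
    have h' : T.hB.src X = T.hB.src Y := by
      rw [← h]; conv_rhs => rw [hX]
      rw [T.hB.tgt_id]; rfl
    have hX' : X = T.hB.id (T.hB.src Y) := by rw [← h']; exact hX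
    subst hX'
    have e' : Y = A := by rw [← e, T.hB.id_comp]
    rw [e']
  · intro hn
    exact absurd (T.mem_horFactorizations.2 ⟨T.hB.tgt_id _, T.hB.id_comp A⟩) hn

theorem counit_right_box [Fintype B] (A : B) :
    LinearMap.lTensor _ (T.counitLin k ϑ) (T.comulLin k ϑ (T.box k ϑ A)) =
      T.box k ϑ A ⊗ₜ[k] (1 : k) := by
  classical
  simp only [comulLin_box, map_sum, map_smul, LinearMap.lTensor_tmul, counitLin_box]
  rw [Finset.sum_eq_single (A, T.hB.id (T.hB.tgt A))]
  · simp only [left, T.hB.src_id, if_true, ← TensorProduct.tmul_smul]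
    simp
  · rintro ⟨X, Y⟩ hp hne
    obtain ⟨h, e⟩ := T.mem_horFactorizations.1 hp
    simp only at h e hne ⊢
    rw [if_neg, TensorProduct.tmul_zero, smul_zero]
    intro hY
    apply hne
    have hY' : Y = T.hB.id (T.hB.tgt X) := by rw [h]; exact hY
    subst hY'
    have e' : X = A := by rw [← e, T.hB.comp_id]
    rw [e']
  · intro hn
    exact absurd (T.mem_horFactorizations.2 ⟨(T.hB.src_id _).symm, T.hB.comp_id A⟩) hn

noncomputable instance [Fintype B] : Coalgebra k (T.Alg k ϑ) where
  comul := T.comulLin k ϑ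
  counit := T.counitLin k ϑ
  coassoc := (T.box k ϑ).ext fun A => T.coassoc_box k ϑ A
  rTensor_counit_comp_comul := (T.box k ϑ).ext fun A => T.counit_left_box k ϑ A
  lTensor_counit_comp_comul := (T.box k ϑ).ext fun A => T.counit_right_box k ϑ A

/-- The antipode: `S(A) = ϑ(rt(A)) / ϑ(rb(A)) A⁻¹`. -/
noncomputable def antipode : T.Alg k ϑ →ₗ[k] T.Alg k ϑ :=
  (T.box k ϑ).constr k fun A => ((ϑ (T.rt A) / ϑ (T.rb A) : kˣ) : k) • T.box k ϑ (T.boxInv A)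

/-- The rescaled boxes `A̲ = ϑ(lb(A)) A`; in this basis `Δ(A̲) = ∑_{XY = A} X̲ ⊗ Y̲`. -/
noncomputable def rbox (A : B) : T.Alg k ϑ := (ϑ (T.lb A) : k) • T.box k ϑ A

/-- The function `μ(A) = ϑ(lt(A)) / ϑ(rt(A))` on boxes. -/
noncomputable def mu (A : B) : k := (ϑ (T.lt A) : k) / (ϑ (T.rt A) : k)

end Algebra

end DoubleGroupoid

/-!
# Weak Hopf algebras from double groupoids, and their duality under transposition

Write `A / C` for vertical and `AC` for horizontal composition of boxes. The double groupoid axioms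
are restated for a total composition `GroupoidOn.mul`, which removes the proof arguments from terms;
every statement about boxes is then proved by solving equations in the two groupoids of boxes and
applying the interchange law.

*Multiplicativity of `Δ`.* A factorization `XY` of `A / C` refines to a two by two array as soon as
the box `U` in its top right corner is chosen; `U` has prescribed top and right sides, and
the weights `ϑ(lb(U))` of all choices add up to `1` (`comul_mul_box`).

*The axiom on `Δ²(1)`.* `Δ(1)` is the weighted sum of all factorizations of vertical identities. Two
such factorizations `(X, Y)` and `(Z, W)` with `Y` and `Z` vertically composable glue to
a factorization `XQW` of a vertical identity, where `Q` is the composite of `Y` and `Z`; conversely,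
`X`, `Q` and `W` determine `Y` and `Z` (`comul_comul_one_eq_below`, `comul_comul_one_eq_above`).

*The antipode.* Both `A₁ S(A₂)` and `ε_t(A)` vanish unless the bottom side of `A` is an identity,
and are otherwise the same multiple of the sum of the boxes `(id / A⁻¹) id_x`, over the horizontal
arrows `x` that start at `lt(A)`; for the first of them this uses the normalization of `ϑ` once
more. The case of `S(A₁) A₂` and `ε_s(A)` is similar. Inserting the formula for
`A₁ S(A₂)` into `S(A₁) A₂ S(A₃)`, all surviving terms are multiples of `A⁻¹`, and their weights add
up to that of `S(A)`.

*Duality.* The form `pairing`, diagonal in the bases of boxes with nonzero entries, is compatible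
with all structure maps. This gives the two axioms on `ε(abc)`, since under a pairing they are
adjoint to the axioms on `Δ²(1)` for the transpose
(`IsWeakHopfPairing.counit_mul_mul`). The normalization of `ϑ` is invariant under transposition
(`IsCornerFunction.transpose`), so the transpose also gives a weak Hopf algebra. As the pairing is
perfect, this algebra is isomorphic to the dual space with its transposed structure
(`IsWeakHopfPairing.equivDual`), which is hence a weak Hopf algebra too.
-/

/-! ### Groupoids with total composition -/

namespace GroupoidOn

variable {G P : Type*} (𝒢 : GroupoidOn G P)

open Classical in
/-- Composition as a total function; it takes the junk value `f` when `f` and `g` are not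
composable. -/
noncomputable def mul (f g : G) : G := if h : 𝒢.tgt f = 𝒢.src g then 𝒢.comp f g h else f

theorem comp_eq_mul {f g : G} (h : 𝒢.tgt f = 𝒢.src g) : 𝒢.comp f g h = 𝒢.mul f g := by
  rw [mul, dif_pos h]

variable {𝒢} {f g k : G} {p : P}

theorem src_mul (h : 𝒢.tgt f = 𝒢.src g) : 𝒢.src (𝒢.mul f g) = 𝒢.src f := by
  rw [← comp_eq_mul _ h, src_comp]

theorem tgt_mul (h : 𝒢.tgt f = 𝒢.src g) : 𝒢.tgt (𝒢.mul f g) = 𝒢.tgt g := by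
  rw [← comp_eq_mul _ h, tgt_comp]

theorem mul_assoc (h₁ : 𝒢.tgt f = 𝒢.src g) (h₂ : 𝒢.tgt g = 𝒢.src k) :
    𝒢.mul (𝒢.mul f g) k = 𝒢.mul f (𝒢.mul g k) := by
  simp only [← 𝒢.comp_eq_mul h₁, ← 𝒢.comp_eq_mul h₂]
  rw [← 𝒢.comp_eq_mul ((𝒢.tgt_comp f g h₁).trans h₂), 𝒢.assoc f g k h₁ h₂, comp_eq_mul]

theorem id_mul (h : 𝒢.src f = p) : 𝒢.mul (𝒢.id p) f = f := by
  subst h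
  rw [← 𝒢.comp_eq_mul (𝒢.tgt_id _), id_comp]

theorem mul_id (h : 𝒢.tgt f = p) : 𝒢.mul f (𝒢.id p) = f := by
  subst h
  rw [← 𝒢.comp_eq_mul (𝒢.src_id _).symm, comp_id]

theorem inv_mul : 𝒢.mul (𝒢.inv f) f = 𝒢.id (𝒢.tgt f) := by
  rw [← 𝒢.comp_eq_mul (𝒢.tgt_inv _), inv_comp]

theorem mul_inv : 𝒢.mul f (𝒢.inv f) = 𝒢.id (𝒢.src f) := by
  rw [← 𝒢.comp_eq_mul (𝒢.src_inv _).symm, comp_inv]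

theorem inv_mul_cancel_left (h : 𝒢.tgt f = 𝒢.src g) : 𝒢.mul (𝒢.inv f) (𝒢.mul f g) = g := by
  rw [← mul_assoc (𝒢.tgt_inv f) h, inv_mul, id_mul h.symm]

theorem mul_inv_cancel_left (h : 𝒢.src f = 𝒢.src g) : 𝒢.mul f (𝒢.mul (𝒢.inv f) g) = g := by
  rw [← mul_assoc (𝒢.src_inv f).symm ((𝒢.tgt_inv f).trans h), mul_inv, id_mul h.symm]

theorem mul_inv_cancel_right (h : 𝒢.tgt f = 𝒢.src g) : 𝒢.mul (𝒢.mul f g) (𝒢.inv g) = f := by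
  rw [mul_assoc h (𝒢.src_inv g).symm, mul_inv, mul_id h]

theorem inv_mul_cancel_right (h : 𝒢.tgt f = 𝒢.tgt g) : 𝒢.mul (𝒢.mul f (𝒢.inv g)) g = f := by
  rw [mul_assoc (h.trans (𝒢.src_inv g).symm) (𝒢.tgt_inv g), inv_mul, mul_id h]

theorem eq_inv_of_mul_eq_id (h : 𝒢.tgt f = 𝒢.src g) (e : 𝒢.mul f g = 𝒢.id p) : g = 𝒢.inv f := by
  have hp : 𝒢.src f = p := by rw [← src_mul h, e, src_id]
  have hg : 𝒢.tgt g = p := by rw [← tgt_mul h, e, tgt_id]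
  rw [← inv_mul_cancel_left h, e, mul_id (by rw [tgt_inv, hp])]

theorem inv_inv : 𝒢.inv (𝒢.inv f) = f :=
  (eq_inv_of_mul_eq_id (𝒢.tgt_inv f) inv_mul).symm

theorem inv_id : 𝒢.inv (𝒢.id p) = 𝒢.id p := by
  refine (eq_inv_of_mul_eq_id (p := p) (by rw [tgt_id, src_id]) ?_).symm
  rw [id_mul (𝒢.src_id p)]

theorem inv_mul_rev (h : 𝒢.tgt f = 𝒢.src g) :
    𝒢.inv (𝒢.mul f g) = 𝒢.mul (𝒢.inv g) (𝒢.inv f) := by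
  have h' : 𝒢.tgt (𝒢.inv g) = 𝒢.src (𝒢.inv f) := by rw [tgt_inv, src_inv, h]
  refine (eq_inv_of_mul_eq_id (p := 𝒢.src f) ?_ ?_).symm
  · rw [tgt_mul h, src_mul h', src_inv]
  · rw [← mul_assoc (by rw [tgt_mul h, src_inv]) h', mul_inv_cancel_right h, mul_inv]

theorem mul_left_cancel (hg : 𝒢.tgt f = 𝒢.src g) (hk : 𝒢.tgt f = 𝒢.src k)
    (e : 𝒢.mul f g = 𝒢.mul f k) : g = k := by
  rw [← inv_mul_cancel_left hg, e, inv_mul_cancel_left hk]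

theorem mul_eq_id_iff (h : 𝒢.tgt f = 𝒢.src g) : 𝒢.mul f g = 𝒢.id (𝒢.src f) ↔ g = 𝒢.inv f :=
  ⟨eq_inv_of_mul_eq_id h, fun e => by rw [e, mul_inv]⟩

end GroupoidOn

/-! ### Sides and inverses of composite boxes -/

namespace DoubleGroupoid

open GroupoidOn

variable {B H V P : Type*} (T : DoubleGroupoid B H V P)

theorem src_hmul {A C : B} (h : T.hB.tgt A = T.hB.src C) :
    T.vB.src (T.hB.mul A C) = T.gH.mul (T.vB.src A) (T.vB.src C) := by
  rw [← T.hB.comp_eq_mul h, T.top_hcomp A C h, comp_eq_mul]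

theorem tgt_hmul {A C : B} (h : T.hB.tgt A = T.hB.src C) :
    T.vB.tgt (T.hB.mul A C) = T.gH.mul (T.vB.tgt A) (T.vB.tgt C) := by
  rw [← T.hB.comp_eq_mul h, T.bot_hcomp A C h, comp_eq_mul]

theorem src_vmul {A C : B} (h : T.vB.tgt A = T.vB.src C) :
    T.hB.src (T.vB.mul A C) = T.gV.mul (T.hB.src A) (T.hB.src C) :=
  T.transpose.src_hmul h

theorem tgt_vmul {A C : B} (h : T.vB.tgt A = T.vB.src C) :
    T.hB.tgt (T.vB.mul A C) = T.gV.mul (T.hB.tgt A) (T.hB.tgt C) :=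
  T.transpose.tgt_hmul h

theorem hmul_vid {x y : H} (h : T.gH.tgt x = T.gH.src y) :
    T.hB.mul (T.vB.id x) (T.vB.id y) = T.vB.id (T.gH.mul x y) := by
  rw [← T.gH.comp_eq_mul h, T.vid_comp x y h, comp_eq_mul]

theorem vmul_hid {f g : V} (h : T.gV.tgt f = T.gV.src g) :
    T.vB.mul (T.hB.id f) (T.hB.id g) = T.hB.id (T.gV.mul f g) :=
  T.transpose.hmul_vid h

theorem tgt_src_composable {A C : B} (h : T.hB.tgt A = T.hB.src C) :
    T.gH.tgt (T.vB.src A) = T.gH.src (T.vB.src C) := by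
  rw [T.corner_rt, T.corner_lt, h]

theorem tgt_tgt_composable {A C : B} (h : T.hB.tgt A = T.hB.src C) :
    T.gH.tgt (T.vB.tgt A) = T.gH.src (T.vB.tgt C) := by
  rw [T.corner_rb, T.corner_lb, h]

theorem hinterchange {A C D E : B} (hAC : T.hB.tgt A = T.hB.src C) (hDE : T.hB.tgt D = T.hB.src E)
    (hAD : T.vB.tgt A = T.vB.src D) (hCE : T.vB.tgt C = T.vB.src E) :
    T.vB.mul (T.hB.mul A C) (T.hB.mul D E) = T.hB.mul (T.vB.mul A D) (T.vB.mul C E) := by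
  have := T.interchange A C D E hAC hDE hAD hCE
  simpa only [comp_eq_mul] using this

/-- The horizontal inverse of a box has the inverse top side; the other sides of `T.hB.inv A` and
`T.vB.inv A` follow in the same way. -/
theorem src_hinv (A : B) : T.vB.src (T.hB.inv A) = T.gH.inv (T.vB.src A) := by
  have h := (T.hB.src_inv A).symm
  refine eq_inv_of_mul_eq_id (p := T.gV.src (T.hB.src A)) (T.tgt_src_composable h) ?_
  rw [← T.src_hmul h, GroupoidOn.mul_inv, T.top_hid]

theorem tgt_hinv (A : B) : T.vB.tgt (T.hB.inv A) = T.gH.inv (T.vB.tgt A) := by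
  have h := (T.hB.src_inv A).symm
  refine eq_inv_of_mul_eq_id (p := T.gV.tgt (T.hB.src A)) (T.tgt_tgt_composable h) ?_
  rw [← T.tgt_hmul h, GroupoidOn.mul_inv, T.bot_hid]

theorem src_vinv (A : B) : T.hB.src (T.vB.inv A) = T.gV.inv (T.hB.src A) :=
  T.transpose.src_hinv A

theorem tgt_vinv (A : B) : T.hB.tgt (T.vB.inv A) = T.gV.inv (T.hB.tgt A) :=
  T.transpose.tgt_hinv A

theorem hinv_vmul {A C : B} (h : T.vB.tgt A = T.vB.src C) :
    T.hB.inv (T.vB.mul A C) = T.vB.mul (T.hB.inv A) (T.hB.inv C) := by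
  have hA := (T.hB.src_inv A).symm
  have hC := (T.hB.src_inv C).symm
  have h' : T.vB.tgt (T.hB.inv A) = T.vB.src (T.hB.inv C) := by rw [tgt_hinv, src_hinv, h]
  refine (eq_inv_of_mul_eq_id (p := T.hB.src (T.vB.mul A C)) ?_ ?_).symm
  · rw [T.tgt_vmul h, T.src_vmul h', hA, hC]
  · rw [← T.hinterchange hA hC h h', GroupoidOn.mul_inv, GroupoidOn.mul_inv, T.vmul_hid,
      T.src_vmul h]
    rw [← T.corner_lb, ← T.corner_lt, h]

theorem hinv_vid (x : H) : T.hB.inv (T.vB.id x) = T.vB.id (T.gH.inv x) := by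
  have h : T.gH.tgt x = T.gH.src (T.gH.inv x) := (T.gH.src_inv x).symm
  refine (eq_inv_of_mul_eq_id (p := T.gV.id (T.gH.src x)) ?_ ?_).symm
  · rw [T.right_vid, T.left_vid, h]
  · rw [T.hmul_vid h, GroupoidOn.mul_inv, T.vid_id]

theorem vinv_hmul {A C : B} (h : T.hB.tgt A = T.hB.src C) :
    T.vB.inv (T.hB.mul A C) = T.hB.mul (T.vB.inv A) (T.vB.inv C) :=
  T.transpose.hinv_vmul h

theorem hinv_vinv (A : B) : T.hB.inv (T.vB.inv A) = T.vB.inv (T.hB.inv A) := by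
  have h := (T.vB.src_inv A).symm
  have h' : T.vB.tgt (T.hB.inv A) = T.vB.src (T.hB.inv (T.vB.inv A)) := by
    rw [T.src_hinv, ← h, T.tgt_hinv]
  refine eq_inv_of_mul_eq_id (p := T.gH.inv (T.vB.src A)) h' ?_
  rw [← T.hinv_vmul h, GroupoidOn.mul_inv, T.hinv_vid]

end DoubleGroupoid

namespace DoubleGroupoid

open GroupoidOn

variable {B H V P : Type*} (T : DoubleGroupoid B H V P)

/-! ### Corners, factorizations and the normalization of `ϑ` -/

theorem lt_hinv (A : B) : T.lt (T.hB.inv A) = T.rt A := by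
  simp only [lt, rt, top, T.src_hinv, T.gH.src_inv]

theorem lb_hinv (A : B) : T.lb (T.hB.inv A) = T.rb A := by
  simp only [lb, rb, bot, T.tgt_hinv, T.gH.src_inv]

theorem rb_hinv (A : B) : T.rb (T.hB.inv A) = T.lb A := by
  simp only [lb, rb, bot, T.tgt_hinv, T.gH.tgt_inv]

theorem lt_vinv (A : B) : T.lt (T.vB.inv A) = T.lb A := by
  simp only [lt, lb, top, bot, T.vB.src_inv]

theorem rt_vinv (A : B) : T.rt (T.vB.inv A) = T.rb A := by
  simp only [rt, rb, top, bot, T.vB.src_inv]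

theorem lb_vinv (A : B) : T.lb (T.vB.inv A) = T.lt A := by
  simp only [lt, lb, top, bot, T.vB.tgt_inv]

theorem transpose_rt (A : B) : T.transpose.rt A = T.lb A := (T.corner_lb A).symm

theorem transpose_lb (A : B) : T.transpose.lb A = T.rt A := (T.corner_rt A).symm

theorem transpose_rb (A : B) : T.transpose.rb A = T.rb A := (T.corner_rb A).symm

section Sums

variable [Fintype B] {M : Type*} [AddCommMonoid M]

theorem mem_horFactorizations_iff {A : B} {p : B × B} :
    p ∈ T.horFactorizations A ↔ T.hB.tgt p.1 = T.hB.src p.2 ∧ T.hB.mul p.1 p.2 = A := by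
  rw [mem_horFactorizations]
  constructor
  · rintro ⟨h, e⟩
    exact ⟨h, by rw [← T.hB.comp_eq_mul h, e]⟩
  · rintro ⟨h, e⟩
    exact ⟨h, by rw [T.hB.comp_eq_mul h, e]⟩

open Classical in
/-- A horizontal factorization of `A` is determined by its left factor. -/
theorem sum_horFactorizations_left (A : B) (F : B × B → M) :
    ∑ p ∈ T.horFactorizations A, F p =
      ∑ X with T.hB.src X = T.hB.src A, F (X, T.hB.mul (T.hB.inv X) A) := by
  refine Finset.sum_bij' (fun p _ => p.1) (fun X _ => (X, T.hB.mul (T.hB.inv X) A)) ?_ ?_ ?_ ?_ ?_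
  · rintro ⟨X, Y⟩ hp
    obtain ⟨h, rfl⟩ := T.mem_horFactorizations_iff.1 hp
    simpa using (src_mul h).symm
  · intro X hX
    simp only [Finset.mem_filter, Finset.mem_univ, true_and] at hX
    refine T.mem_horFactorizations_iff.2 ⟨?_, mul_inv_cancel_left hX⟩
    rw [src_mul (by rw [tgt_inv, hX]), src_inv]
  · rintro ⟨X, Y⟩ hp
    obtain ⟨h, rfl⟩ := T.mem_horFactorizations_iff.1 hp
    simp only [inv_mul_cancel_left h]
  · intro X hX
    rfl
  · rintro ⟨X, Y⟩ hp
    obtain ⟨h, rfl⟩ := T.mem_horFactorizations_iff.1 hp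
    simp only [inv_mul_cancel_left h]

open Classical in
/-- A horizontal factorization of `A` is determined by its right factor. -/
theorem sum_horFactorizations_right (A : B) (F : B × B → M) :
    ∑ p ∈ T.horFactorizations A, F p =
      ∑ Y with T.hB.tgt Y = T.hB.tgt A, F (T.hB.mul A (T.hB.inv Y), Y) := by
  refine Finset.sum_bij' (fun p _ => p.2) (fun Y _ => (T.hB.mul A (T.hB.inv Y), Y)) ?_ ?_ ?_ ?_ ?_
  · rintro ⟨X, Y⟩ hp
    obtain ⟨h, rfl⟩ := T.mem_horFactorizations_iff.1 hp
    simpa using (tgt_mul h).symm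
  · intro Y hY
    simp only [Finset.mem_filter, Finset.mem_univ, true_and] at hY
    refine T.mem_horFactorizations_iff.2 ⟨?_, inv_mul_cancel_right hY.symm⟩
    rw [tgt_mul (by rw [src_inv, hY]), tgt_inv]
  · rintro ⟨X, Y⟩ hp
    obtain ⟨h, rfl⟩ := T.mem_horFactorizations_iff.1 hp
    simp only [mul_inv_cancel_right h]
  · intro Y hY
    rfl
  · rintro ⟨X, Y⟩ hp
    obtain ⟨h, rfl⟩ := T.mem_horFactorizations_iff.1 hp
    simp only [mul_inv_cancel_right h]

end Sums

section Corner

variable [Fintype B] {T} {k : Type*} [Field k] {ϑ : P → kˣ}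

open Classical in
theorem IsCornerFunction.sum_top_right (hϑ : T.IsCornerFunction k ϑ) {g : V} {x : H}
    (h : T.gV.src g = T.gH.tgt x) :
    ∑ U : B with T.vB.src U = x ∧ T.hB.tgt U = g, (ϑ (T.lb U) : k) = 1 := by
  convert hϑ g x h using 1
  exact Finset.sum_congr (Finset.filter_congr_decidable ..) fun _ _ => rfl

open Classical in
theorem IsCornerFunction.sum_top_left (hϑ : T.IsCornerFunction k ϑ) {g : V} {x : H}
    (h : T.gV.src g = T.gH.src x) :
    ∑ U : B with T.vB.src U = x ∧ T.hB.src U = g, (ϑ (T.rb U) : k) = 1 := by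
  rw [← hϑ.sum_top_right (x := T.gH.inv x) (h.trans (T.gH.tgt_inv x).symm)]
  refine Finset.sum_bij' (fun U _ => T.hB.inv U) (fun U _ => T.hB.inv U) ?_ ?_ ?_ ?_ ?_ <;>
    simp +contextual [T.src_hinv, T.lb_hinv, GroupoidOn.inv_inv, src_inv, tgt_inv]

open Classical in
theorem IsCornerFunction.sum_bot_right (hϑ : T.IsCornerFunction k ϑ) {g : V} {x : H}
    (h : T.gV.tgt g = T.gH.tgt x) :
    ∑ U : B with T.vB.tgt U = x ∧ T.hB.tgt U = g, (ϑ (T.lt U) : k) = 1 := by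
  rw [← hϑ.sum_top_right (g := T.gV.inv g) ((T.gV.src_inv g).trans h)]
  refine Finset.sum_bij' (fun U _ => T.vB.inv U) (fun U _ => T.vB.inv U) ?_ ?_ ?_ ?_ ?_ <;>
    simp +contextual [T.tgt_vinv, T.lb_vinv, GroupoidOn.inv_inv, src_inv, tgt_inv]

open Classical in
theorem IsCornerFunction.sum_bot_left (hϑ : T.IsCornerFunction k ϑ) {g : V} {x : H}
    (h : T.gV.tgt g = T.gH.src x) :
    ∑ U : B with T.vB.tgt U = x ∧ T.hB.src U = g, (ϑ (T.rt U) : k) = 1 := by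
  rw [← hϑ.sum_bot_right (x := T.gH.inv x) (h.trans (T.gH.tgt_inv x).symm)]
  refine Finset.sum_bij' (fun U _ => T.hB.inv U) (fun U _ => T.hB.inv U) ?_ ?_ ?_ ?_ ?_ <;>
    simp +contextual [T.tgt_hinv, T.lt_hinv, GroupoidOn.inv_inv, src_inv, tgt_inv]

/-- The normalization condition is invariant under transposition: total inversion of boxes
exchanges the two conditions. -/
theorem IsCornerFunction.transpose (hϑ : T.IsCornerFunction k ϑ) :
    T.transpose.IsCornerFunction k ϑ := by
  classical
  intro x g h
  rw [← hϑ.sum_bot_left h.symm]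
  refine Finset.sum_congr ?_ fun U _ => by rw [transpose_lb]
  ext U
  simp only [Finset.mem_filter, Finset.mem_univ, true_and]
  exact and_comm

end Corner

end DoubleGroupoid

namespace DoubleGroupoid

open GroupoidOn

variable {B H V P : Type*} (T : DoubleGroupoid B H V P)

/-! ### Multiplicativity of the comultiplication -/

/-- A horizontal factorization `XY` of a vertical composite `A / C`, together with a box `U` that
fits at the top of `Y` along the right side of `A`, cuts into a two by two array: `U` extends to
horizontal factorizations of `A` and of `C` which compose vertically to `X` and `Y`. -/
theorem factorization_of_vmul {A C X Y U : B} (h : T.vB.tgt A = T.vB.src C)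
    (hXY : T.hB.tgt X = T.hB.src Y) (e : T.hB.mul X Y = T.vB.mul A C)
    (hU : T.vB.src U = T.vB.src Y) (hUA : T.hB.tgt U = T.hB.tgt A) :
    T.hB.tgt (T.vB.mul (T.vB.inv U) Y) = T.hB.tgt C ∧
    T.vB.tgt U = T.vB.src (T.vB.mul (T.vB.inv U) Y) ∧
    T.vB.tgt (T.hB.mul A (T.hB.inv U)) =
      T.vB.src (T.hB.mul C (T.hB.inv (T.vB.mul (T.vB.inv U) Y))) ∧
    T.vB.mul (T.hB.mul A (T.hB.inv U)) (T.hB.mul C (T.hB.inv (T.vB.mul (T.vB.inv U) Y))) = X := by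
  obtain ⟨W, hW⟩ : ∃ W, W = T.vB.mul (T.vB.inv U) Y := ⟨_, rfl⟩
  rw [← hW]
  have hUW : T.vB.tgt U = T.vB.src W := by
    rw [hW, src_mul (by rw [tgt_inv, hU]), src_inv]
  have hY : T.vB.mul U W = Y := by rw [hW, mul_inv_cancel_left hU]
  have hWC : T.hB.tgt W = T.hB.tgt C := by
    have h₁ : T.gV.mul (T.hB.tgt U) (T.hB.tgt W) = T.gV.mul (T.hB.tgt U) (T.hB.tgt C) := by
      rw [← T.tgt_vmul hUW, hUA, ← T.tgt_vmul h, ← e, tgt_mul hXY, hY]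
    refine mul_left_cancel ?_ ?_ h₁
    · exact T.transpose.tgt_tgt_composable hUW
    · rw [hUA]
      exact T.transpose.tgt_tgt_composable h
  have hA' : T.hB.tgt A = T.hB.src (T.hB.inv U) := by rw [src_inv, hUA]
  have hC' : T.hB.tgt C = T.hB.src (T.hB.inv W) := by rw [src_inv, hWC]
  have hinv : T.vB.tgt (T.hB.inv U) = T.vB.src (T.hB.inv W) := by
    rw [T.tgt_hinv, T.src_hinv, hUW]
  refine ⟨hWC, hUW, ?_, ?_⟩
  · rw [T.tgt_hmul hA', T.src_hmul hC', h, hinv]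
  · rw [T.hinterchange hA' hC' h hinv, ← e, ← T.hinv_vmul hUW, hY, mul_inv_cancel_right hXY]

section Comul

variable {k : Type*} [Field k] (ϑ : P → kˣ)

variable {T ϑ} in
theorem Alg.induction {p : T.Alg k ϑ → Prop} (a : T.Alg k ϑ) (box : ∀ A, p (T.box k ϑ A))
    (zero : p 0) (add : ∀ a b, p a → p b → p (a + b)) (smul : ∀ (c : k) a, p a → p (c • a)) :
    p a := by
  have ha : a ∈ Submodule.span k (Set.range (T.box k ϑ)) := (T.box k ϑ).mem_span a
  induction ha using Submodule.span_induction with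
  | mem x hx => obtain ⟨A, rfl⟩ := hx; exact box A
  | zero => exact zero
  | add x y _ _ hx hy => exact add x y hx hy
  | smul c x _ hx => exact smul c x hx

open Classical in
theorem box_mul (A C : B) : T.box k ϑ A * T.box k ϑ C =
    if T.vB.tgt A = T.vB.src C then T.box k ϑ (T.vB.mul A C) else 0 := by
  split_ifs with h
  · rw [T.box_mul_of_eq k ϑ A C h, comp_eq_mul]
  · exact T.box_mul_of_ne k ϑ A C h

theorem comul_box [Fintype B] (A : B) : Coalgebra.comul (R := k) (T.box k ϑ A) =
    ∑ p ∈ T.horFactorizations A, (ϑ (T.lb p.2) : k) • (T.box k ϑ p.1 ⊗ₜ[k] T.box k ϑ p.2) :=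
  T.comulLin_box k ϑ A

open Classical in
theorem counit_box [Fintype B] (A : B) : Coalgebra.counit (R := k) (T.box k ϑ A) =
    if A = T.hB.id (T.hB.src A) then (ϑ (T.lb A) : k)⁻¹ else 0 := by
  have := T.counitLin_box k ϑ A
  rw [Units.val_inv_eq_inv_val] at this
  exact this

theorem antipode_box (A : B) : T.antipode k ϑ (T.box k ϑ A) =
    ((ϑ (T.rt A) : k) / ϑ (T.rb A)) • T.box k ϑ (T.boxInv A) := by
  simp [antipode]

/-- The comultiplication is multiplicative: the factorizations of `A / C` are cut into
factorizations of `A` and of `C`, and the normalization of `ϑ` accounts for the choice of the cut. -/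
theorem comul_mul_box [Fintype B] [Fintype H] (hϑ : T.IsCornerFunction k ϑ) (A C : B) :
    Coalgebra.comul (R := k) (T.box k ϑ A * T.box k ϑ C) =
      Coalgebra.comul (R := k) (T.box k ϑ A) * Coalgebra.comul (R := k) (T.box k ϑ C) := by
  classical
  -- The product of the coproducts is a sum over pairs of factorizations that fit vertically.
  have hR : Coalgebra.comul (R := k) (T.box k ϑ A) * Coalgebra.comul (R := k) (T.box k ϑ C) =
      ∑ p ∈ T.horFactorizations A ×ˢ T.horFactorizations C with
        T.vB.tgt p.1.1 = T.vB.src p.2.1 ∧ T.vB.tgt p.1.2 = T.vB.src p.2.2,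
      ((ϑ (T.lb p.1.2) : k) * ϑ (T.lb p.2.2)) •
        (T.box k ϑ (T.vB.mul p.1.1 p.2.1) ⊗ₜ[k] T.box k ϑ (T.vB.mul p.1.2 p.2.2)) := by
    rw [comul_box, comul_box, Finset.sum_mul_sum, ← Finset.sum_product', Finset.sum_filter]
    refine Finset.sum_congr rfl fun p _ => ?_
    rw [smul_mul_smul_comm, Algebra.TensorProduct.tmul_mul_tmul, box_mul, box_mul]
    split_ifs <;> simp_all
  rw [hR, box_mul]
  split_ifs with h
  · rw [comul_box]
    -- By the normalization of `ϑ`, each term of `Δ(A / C)` is spread over the possible cuts `U`.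
    have hL : ∀ r ∈ T.horFactorizations (T.vB.mul A C),
        (ϑ (T.lb r.2) : k) • (T.box k ϑ r.1 ⊗ₜ[k] T.box k ϑ r.2) =
        ∑ U with T.vB.src U = T.vB.src r.2 ∧ T.hB.tgt U = T.hB.tgt A,
          ((ϑ (T.lb U) : k) * ϑ (T.lb r.2)) • (T.box k ϑ r.1 ⊗ₜ[k] T.box k ϑ r.2) := by
      rintro ⟨X, Y⟩ hr
      obtain ⟨hXY, e⟩ := T.mem_horFactorizations_iff.1 hr
      simp only at hXY e ⊢
      rw [← Finset.sum_smul, ← Finset.sum_mul, hϑ.sum_top_right, one_mul]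
      rw [T.corner_rt, ← tgt_mul hXY, e, T.tgt_vmul h, src_mul]
      rw [← T.corner_rb, ← T.corner_rt, h]
    rw [Finset.sum_congr rfl hL, Finset.sum_sigma']
    symm
    refine Finset.sum_bij'
      (fun p _ => ⟨(T.vB.mul p.1.1 p.2.1, T.vB.mul p.1.2 p.2.2), p.1.2⟩)
      (fun q _ => ((T.hB.mul A (T.hB.inv q.2), q.2),
        (T.hB.mul C (T.hB.inv (T.vB.mul (T.vB.inv q.2) q.1.2)), T.vB.mul (T.vB.inv q.2) q.1.2)))
      ?_ ?_ ?_ ?_ ?_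
    · rintro ⟨⟨X, Y⟩, ⟨Z, W⟩⟩ hp
      simp only [Finset.mem_filter, Finset.mem_product, mem_horFactorizations_iff,
        Finset.mem_sigma, Finset.mem_univ, true_and] at hp ⊢
      obtain ⟨⟨⟨hXY, rfl⟩, ⟨hZW, rfl⟩⟩, hXZ, hYW⟩ := hp
      refine ⟨⟨by rw [T.tgt_vmul hXZ, T.src_vmul hYW, hXY, hZW], ?_⟩, (src_mul hYW).symm,
        (tgt_mul hXY).symm⟩
      exact (T.hinterchange hXY hZW hXZ hYW).symm
    · rintro ⟨⟨X, Y⟩, U⟩ hq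
      simp only [Finset.mem_filter, Finset.mem_product, mem_horFactorizations_iff,
        Finset.mem_sigma, Finset.mem_univ, true_and] at hq ⊢
      obtain ⟨⟨hXY, e⟩, hU, hUA⟩ := hq
      obtain ⟨h₁, h₂, h₃, -⟩ := T.factorization_of_vmul h hXY e hU hUA
      refine ⟨⟨⟨?_, inv_mul_cancel_right hUA.symm⟩, ?_, inv_mul_cancel_right h₁.symm⟩, h₃, h₂⟩
      · rw [tgt_mul (by rw [src_inv, hUA]), tgt_inv]
      · rw [tgt_mul (by rw [src_inv, h₁]), tgt_inv]
    · rintro ⟨⟨X, Y⟩, ⟨Z, W⟩⟩ hp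
      simp only [Finset.mem_filter, Finset.mem_product, mem_horFactorizations_iff] at hp
      obtain ⟨⟨⟨hXY, rfl⟩, ⟨hZW, rfl⟩⟩, hXZ, hYW⟩ := hp
      simp only [inv_mul_cancel_left hYW, mul_inv_cancel_right hXY, mul_inv_cancel_right hZW]
    · rintro ⟨⟨X, Y⟩, U⟩ hq
      simp only [Finset.mem_filter, mem_horFactorizations_iff, Finset.mem_sigma, Finset.mem_univ,
        true_and] at hq
      obtain ⟨⟨hXY, e⟩, hU, hUA⟩ := hq
      obtain ⟨-, -, -, h₄⟩ := T.factorization_of_vmul h hXY e hU hUA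
      simp only [h₄, mul_inv_cancel_left hU]
    · rintro ⟨⟨X, Y⟩, ⟨Z, W⟩⟩ hp
      simp only [Finset.mem_filter, Finset.mem_product, mem_horFactorizations_iff] at hp
      obtain ⟨⟨⟨hXY, rfl⟩, ⟨hZW, rfl⟩⟩, hXZ, hYW⟩ := hp
      simp only [lb, bot, tgt_mul hYW]
  · rw [map_zero, Finset.filter_false_of_mem, Finset.sum_empty]
    rintro ⟨⟨X, Y⟩, ⟨Z, W⟩⟩ hp ⟨hXZ, hYW⟩
    simp only [Finset.mem_product, mem_horFactorizations_iff] at hp hXZ hYW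
    obtain ⟨⟨hXY, rfl⟩, ⟨hZW, rfl⟩⟩ := hp
    exact h (by rw [T.tgt_hmul hXY, T.src_hmul hZW, hXZ, hYW])

end Comul

end DoubleGroupoid

/-! ### The comultiplication of the unit -/

section TensorSums

variable {k A ι : Type*} [Field k] [Ring A] [Algebra k A] (s t : Finset ι) (c d : ι → k)
  (x y z w : ι → A)

theorem assoc_sum_tmul_one_mul :
    TensorProduct.assoc k A A A ((∑ p ∈ s, c p • (x p ⊗ₜ[k] y p)) ⊗ₜ[k] 1) *
        (1 ⊗ₜ[k] ∑ q ∈ t, d q • (z q ⊗ₜ[k] w q)) =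
      ∑ p ∈ s ×ˢ t, (c p.1 * d p.2) • (x p.1 ⊗ₜ[k] ((y p.1 * z p.2) ⊗ₜ[k] w p.2)) := by
  rw [TensorProduct.sum_tmul, map_sum, TensorProduct.tmul_sum, Finset.sum_product,
    Finset.sum_mul_sum]
  refine Finset.sum_congr rfl fun p _ => Finset.sum_congr rfl fun q _ => ?_
  rw [← TensorProduct.smul_tmul', map_smul, TensorProduct.assoc_tmul, TensorProduct.tmul_smul,
    smul_mul_smul_comm, Algebra.TensorProduct.tmul_mul_tmul,
    Algebra.TensorProduct.tmul_mul_tmul, one_mul, mul_one]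

theorem one_tmul_mul_assoc_sum :
    (1 ⊗ₜ[k] ∑ q ∈ t, d q • (z q ⊗ₜ[k] w q)) *
        TensorProduct.assoc k A A A ((∑ p ∈ s, c p • (x p ⊗ₜ[k] y p)) ⊗ₜ[k] 1) =
      ∑ p ∈ s ×ˢ t, (c p.1 * d p.2) • (x p.1 ⊗ₜ[k] ((z p.2 * y p.1) ⊗ₜ[k] w p.2)) := by
  rw [TensorProduct.sum_tmul, map_sum, TensorProduct.tmul_sum, Finset.sum_product_right,
    Finset.sum_mul_sum]
  refine Finset.sum_congr rfl fun p _ => Finset.sum_congr rfl fun q _ => ?_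
  rw [← TensorProduct.smul_tmul', map_smul, TensorProduct.assoc_tmul, TensorProduct.tmul_smul,
    smul_mul_smul_comm, Algebra.TensorProduct.tmul_mul_tmul,
    Algebra.TensorProduct.tmul_mul_tmul, one_mul, mul_one, mul_comm (d p)]

end TensorSums

namespace DoubleGroupoid

open GroupoidOn

variable {B H V P : Type*} (T : DoubleGroupoid B H V P)

/-- The pair `(X, Y)` is a horizontal factorization of a vertical identity. -/
def IsVidFactorization (p : B × B) : Prop :=
  T.hB.tgt p.1 = T.hB.src p.2 ∧ ∃ x, T.hB.mul p.1 p.2 = T.vB.id x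

variable {T}

namespace IsVidFactorization

variable {X Y : B}

theorem mul_eq (h : T.IsVidFactorization (X, Y)) :
    T.hB.mul X Y = T.vB.id (T.gH.mul (T.vB.src X) (T.vB.src Y)) := by
  obtain ⟨hXY, x, e⟩ := h
  rw [← T.src_hmul hXY, e, src_id]

theorem mul_eq' (h : T.IsVidFactorization (X, Y)) :
    T.hB.mul X Y = T.vB.id (T.gH.mul (T.vB.tgt X) (T.vB.tgt Y)) := by
  obtain ⟨hXY, x, e⟩ := h
  rw [← T.tgt_hmul hXY, e, tgt_id]

theorem src_eq (h : T.IsVidFactorization (X, Y)) :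
    T.hB.src X = T.gV.id (T.gH.src (T.vB.src X)) := by
  obtain ⟨hXY, x, e⟩ := h
  have : T.hB.src X = T.gV.id (T.gH.src x) := by rw [← src_mul hXY, e, T.left_vid]
  rw [T.corner_lt, this, src_id]

theorem tgt_eq (h : T.IsVidFactorization (X, Y)) :
    T.hB.tgt Y = T.gV.id (T.gH.tgt (T.vB.src Y)) := by
  obtain ⟨hXY, x, e⟩ := h
  have : T.hB.tgt Y = T.gV.id (T.gH.tgt x) := by rw [← tgt_mul hXY, e, T.right_vid]
  rw [T.corner_rt, this, src_id]

/-- The right factor is determined by the left factor and its top side. -/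
theorem eq_inv_mul (h : T.IsVidFactorization (X, Y)) :
    Y = T.hB.mul (T.hB.inv X) (T.vB.id (T.gH.mul (T.vB.src X) (T.vB.src Y))) := by
  rw [← h.mul_eq, inv_mul_cancel_left h.1]

/-- The right factor is determined by the left factor and its bottom side. -/
theorem eq_inv_mul' (h : T.IsVidFactorization (X, Y)) :
    Y = T.hB.mul (T.hB.inv X) (T.vB.id (T.gH.mul (T.vB.tgt X) (T.vB.tgt Y))) := by
  rw [← h.mul_eq', inv_mul_cancel_left h.1]

/-- In `X(Y / Z)`, the box `X` can be pushed up: `X(Y / Z) = (XY) / (id Z)`, and `XY` is a vertical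
identity. -/
theorem mul_vmul_below {Z : B} (h : T.IsVidFactorization (X, Y)) (hYZ : T.vB.tgt Y = T.vB.src Z)
    {p : P} (hZ : T.hB.src Z = T.gV.id p) :
    T.hB.mul X (T.vB.mul Y Z) = T.hB.mul (T.vB.id (T.vB.tgt X)) Z := by
  have hc : T.gH.tgt (T.vB.tgt X) = T.gH.src (T.vB.tgt Y) := T.tgt_tgt_composable h.1
  have hp : T.hB.tgt (T.vB.id (T.vB.tgt X)) = T.hB.src Z := by
    rw [T.right_vid, hc, hYZ, T.corner_lt, hZ, src_id]
  conv_lhs => rw [← mul_id (𝒢 := T.vB) (f := X) rfl]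
  rw [← T.hinterchange h.1 hp (T.vB.src_id _).symm hYZ, h.mul_eq', id_mul]
  rw [T.src_hmul hp, hYZ, src_id]

/-- In `X(Z / Y)`, the box `X` can be pushed down: `X(Z / Y) = (id Z) / (XY)`, and `XY` is a
vertical identity. -/
theorem mul_vmul_above {Z : B} (h : T.IsVidFactorization (X, Y)) (hZY : T.vB.tgt Z = T.vB.src Y)
    {p : P} (hZ : T.hB.src Z = T.gV.id p) :
    T.hB.mul X (T.vB.mul Z Y) = T.hB.mul (T.vB.id (T.vB.src X)) Z := by
  have hc : T.gH.tgt (T.vB.src X) = T.gH.src (T.vB.src Y) := T.tgt_src_composable h.1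
  have hp : T.hB.tgt (T.vB.id (T.vB.src X)) = T.hB.src Z := by
    rw [T.right_vid, hc, ← hZY, T.corner_lb, hZ, tgt_id]
  conv_lhs => rw [← id_mul (𝒢 := T.vB) (f := X) rfl]
  rw [← T.hinterchange hp h.1 (T.vB.tgt_id _) hZY, h.mul_eq, mul_id]
  rw [T.tgt_hmul hp, hZY, tgt_id]

end IsVidFactorization

/-- If the left side of `X` is an identity, then `X` is the left factor of every vertical identity
with a suitable source. -/
theorem isVidFactorization_of_src {X : B} {p : P} {x : H} (hX : T.hB.src X = T.gV.id p)
    (hx : T.gH.src x = p) :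
    T.IsVidFactorization (X, T.hB.mul (T.hB.inv X) (T.vB.id x)) := by
  have h : T.hB.src X = T.hB.src (T.vB.id x) := by rw [hX, T.left_vid, hx]
  refine ⟨?_, x, mul_inv_cancel_left h⟩
  rw [src_mul (by rw [tgt_inv, h]), src_inv]

/-- If `Q = Y / Z` with `(X, Y)` and `(Z, W)` factorizations of vertical identities, then so is
`(X, QW)`. -/
theorem IsVidFactorization.glue_below {X Y Z W : B} (hXY : T.IsVidFactorization (X, Y))
    (hZW : T.IsVidFactorization (Z, W)) (hYZ : T.vB.tgt Y = T.vB.src Z) :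
    T.hB.src (T.vB.mul Y Z) = T.hB.src Y ∧ T.hB.tgt (T.vB.mul Y Z) = T.hB.src W ∧
    T.IsVidFactorization (X, T.hB.mul (T.vB.mul Y Z) W) := by
  have hl : T.hB.src (T.vB.mul Y Z) = T.hB.src Y := by
    rw [T.src_vmul hYZ, hZW.src_eq, mul_id]
    rw [← T.corner_lb, hYZ]
  have hr : T.hB.tgt (T.vB.mul Y Z) = T.hB.src W := by
    rw [T.tgt_vmul hYZ, hXY.tgt_eq, ← hZW.1, id_mul]
    rw [← T.corner_rt, ← hYZ, T.corner_rb, hXY.tgt_eq, tgt_id]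
  refine ⟨hl, hr, ?_⟩
  have hXQ : T.hB.tgt X = T.hB.src (T.vB.mul Y Z) := by rw [hl, hXY.1]
  refine ⟨by rw [src_mul hr, hXQ], ?_⟩
  have hc : T.gH.tgt (T.vB.tgt X) = T.gH.src (T.vB.src Z) := by
    rw [← hYZ]; exact T.tgt_tgt_composable hXY.1
  have hp : T.hB.tgt (T.vB.id (T.vB.tgt X)) = T.hB.src Z := by
    rw [T.right_vid, hc, hZW.src_eq]
  refine ⟨T.gH.mul (T.vB.tgt X) (T.gH.mul (T.vB.src Z) (T.vB.src W)), ?_⟩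
  rw [← GroupoidOn.mul_assoc hXQ hr, hXY.mul_vmul_below hYZ hZW.src_eq,
    GroupoidOn.mul_assoc hp hZW.1, hZW.mul_eq, T.hmul_vid]
  rw [src_mul (T.tgt_src_composable hZW.1), hc]

/-- If `Q = Z / Y` with `(X, Y)` and `(Z, W)` factorizations of vertical identities, then so is
`(X, QW)`. -/
theorem IsVidFactorization.glue_above {X Y Z W : B} (hXY : T.IsVidFactorization (X, Y))
    (hZW : T.IsVidFactorization (Z, W)) (hZY : T.vB.tgt Z = T.vB.src Y) :
    T.hB.src (T.vB.mul Z Y) = T.hB.src Y ∧ T.hB.tgt (T.vB.mul Z Y) = T.hB.src W ∧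
    T.IsVidFactorization (X, T.hB.mul (T.vB.mul Z Y) W) := by
  have hlz : T.gH.src (T.vB.src Z) = T.gH.src (T.vB.src Y) := by
    rw [← hZY, T.corner_lb, hZW.src_eq, tgt_id]
  have hl : T.hB.src (T.vB.mul Z Y) = T.hB.src Y := by
    rw [T.src_vmul hZY, hZW.src_eq, id_mul]
    rw [← T.corner_lt, hlz]
  have hr : T.hB.tgt (T.vB.mul Z Y) = T.hB.src W := by
    rw [T.tgt_vmul hZY, hXY.tgt_eq, hZW.1, mul_id]
    rw [← hZW.1, ← T.corner_rb, hZY]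
  refine ⟨hl, hr, ?_⟩
  have hXQ : T.hB.tgt X = T.hB.src (T.vB.mul Z Y) := by rw [hl, hXY.1]
  refine ⟨by rw [src_mul hr, hXQ], ?_⟩
  have hc : T.gH.tgt (T.vB.src X) = T.gH.src (T.vB.src Z) := by
    rw [hlz]; exact T.tgt_src_composable hXY.1
  have hp : T.hB.tgt (T.vB.id (T.vB.src X)) = T.hB.src Z := by
    rw [T.right_vid, hc, hZW.src_eq]
  refine ⟨T.gH.mul (T.vB.src X) (T.gH.mul (T.vB.src Z) (T.vB.src W)), ?_⟩
  rw [← GroupoidOn.mul_assoc hXQ hr, hXY.mul_vmul_above hZY hZW.src_eq,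
    GroupoidOn.mul_assoc hp hZW.1, hZW.mul_eq, T.hmul_vid]
  rw [src_mul (T.tgt_src_composable hZW.1), hc]

theorem isVidFactorization_of_vid_mul {x : H} {Z W : B}
    (hZ : T.hB.tgt (T.vB.id x) = T.hB.src Z) (hZW : T.hB.tgt Z = T.hB.src W)
    {z : H} (e : T.hB.mul (T.hB.mul (T.vB.id x) Z) W = T.vB.id z) :
    T.IsVidFactorization (Z, W) := by
  refine ⟨hZW, T.gH.mul (T.gH.inv x) z, ?_⟩
  rw [GroupoidOn.mul_assoc hZ hZW] at e
  have h : T.hB.tgt (T.vB.id x) = T.hB.src (T.hB.mul Z W) := by rw [src_mul hZW, hZ]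
  rw [← inv_mul_cancel_left h, e, T.hinv_vid, T.hmul_vid]
  rw [tgt_inv, ← T.gV.src_id (T.gH.src x), ← T.left_vid, ← src_mul h, e, T.left_vid, src_id]

/-- The factorization of the middle factor `Q` of a vertical identity `XQW` inverse to
`IsVidFactorization.glue_below`. -/
theorem IsVidFactorization.cut_below {X Q W Y Z : B} (h : T.IsVidFactorization (X, T.hB.mul Q W))
    (hQW : T.hB.tgt Q = T.hB.src W)
    (hY : Y = T.hB.mul (T.hB.inv X) (T.vB.id (T.gH.mul (T.vB.src X) (T.vB.src Q))))
    (hZ : Z = T.vB.mul (T.vB.inv Y) Q) :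
    T.IsVidFactorization (X, Y) ∧ T.IsVidFactorization (Z, W) ∧ T.vB.tgt Y = T.vB.src Z ∧
      T.vB.mul Y Z = Q := by
  have hXQ : T.hB.tgt X = T.hB.src Q := by rw [← src_mul hQW]; exact h.1
  have hXY : T.IsVidFactorization (X, Y) := by
    rw [hY]
    exact isVidFactorization_of_src h.src_eq (src_mul (T.tgt_src_composable hXQ))
  have hYQ : T.vB.src Y = T.vB.src Q := by
    refine mul_left_cancel (T.tgt_src_composable hXY.1) (T.tgt_src_composable hXQ) ?_
    rw [← T.src_hmul hXY.1, hY, mul_inv_cancel_left, src_id]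
    rw [h.src_eq, T.left_vid, src_mul (T.tgt_src_composable hXQ)]
  have hYi : T.vB.tgt (T.vB.inv Y) = T.vB.src Q := by rw [tgt_inv, hYQ]
  have hYZ : T.vB.tgt Y = T.vB.src Z := by rw [hZ, src_mul hYi, src_inv]
  have hQ : T.vB.mul Y Z = Q := by rw [hZ, mul_inv_cancel_left hYQ]
  have hlZ : T.hB.src Z = T.gV.id (T.gH.src (T.vB.tgt Y)) := by
    rw [hZ, T.src_vmul hYi, T.src_vinv, ← hXQ, hXY.1, GroupoidOn.inv_mul, T.corner_lb]
  have hrZ : T.hB.tgt Z = T.hB.src W := by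
    rw [hZ, T.tgt_vmul hYi, T.tgt_vinv, hXY.tgt_eq, inv_id, id_mul, hQW]
    rw [← T.corner_rt, hYQ]
  refine ⟨hXY, ?_, hYZ, hQ⟩
  have hp : T.hB.tgt (T.vB.id (T.vB.tgt X)) = T.hB.src Z := by
    rw [T.right_vid, hlZ, T.tgt_tgt_composable hXY.1]
  refine isVidFactorization_of_vid_mul hp hrZ 
    (z := T.gH.mul (T.vB.src X) (T.vB.src (T.hB.mul Q W))) ?_
  rw [← hXY.mul_vmul_below hYZ hlZ, hQ, GroupoidOn.mul_assoc hXQ hQW, h.mul_eq]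

/-- The factorization of the middle factor `Q` of a vertical identity `XQW` inverse to
`IsVidFactorization.glue_above`. -/
theorem IsVidFactorization.cut_above {X Q W Y Z : B} (h : T.IsVidFactorization (X, T.hB.mul Q W))
    (hQW : T.hB.tgt Q = T.hB.src W)
    (hY : Y = T.hB.mul (T.hB.inv X) (T.vB.id (T.gH.mul (T.vB.tgt X) (T.vB.tgt Q))))
    (hZ : Z = T.vB.mul Q (T.vB.inv Y)) :
    T.IsVidFactorization (X, Y) ∧ T.IsVidFactorization (Z, W) ∧ T.vB.tgt Z = T.vB.src Y ∧
      T.vB.mul Z Y = Q := by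
  have hXQ : T.hB.tgt X = T.hB.src Q := by rw [← src_mul hQW]; exact h.1
  have hlX : T.gH.src (T.vB.tgt X) = T.gH.src (T.vB.src X) := by
    rw [T.corner_lb, h.src_eq, tgt_id]
  have hx := (src_mul (T.tgt_tgt_composable hXQ)).trans hlX
  have hXY : T.IsVidFactorization (X, Y) := by
    rw [hY]
    exact isVidFactorization_of_src h.src_eq hx
  have hYQ : T.vB.tgt Y = T.vB.tgt Q := by
    refine mul_left_cancel (T.tgt_tgt_composable hXY.1) (T.tgt_tgt_composable hXQ) ?_
    rw [← T.tgt_hmul hXY.1, hY, mul_inv_cancel_left, tgt_id]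
    rw [h.src_eq, T.left_vid, hx]
  have hYi : T.vB.tgt Q = T.vB.src (T.vB.inv Y) := by rw [src_inv, hYQ]
  have hZY : T.vB.tgt Z = T.vB.src Y := by rw [hZ, tgt_mul hYi, tgt_inv]
  have hQ : T.vB.mul Z Y = Q := by rw [hZ, inv_mul_cancel_right hYQ.symm]
  have hlZ : T.hB.src Z = T.gV.id (T.gH.src (T.vB.src Y)) := by
    rw [hZ, T.src_vmul hYi, T.src_vinv, ← hXQ, hXY.1, GroupoidOn.mul_inv, T.corner_lt]
  have hrZ : T.hB.tgt Z = T.hB.src W := by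
    rw [hZ, T.tgt_vmul hYi, T.tgt_vinv, hXY.tgt_eq, inv_id, mul_id, hQW]
    rw [← T.corner_rb, ← hYQ, T.corner_rb, hXY.tgt_eq, tgt_id]
  refine ⟨hXY, ?_, hZY, hQ⟩
  have hp : T.hB.tgt (T.vB.id (T.vB.src X)) = T.hB.src Z := by
    rw [T.right_vid, hlZ, T.tgt_src_composable hXY.1]
  refine isVidFactorization_of_vid_mul hp hrZ
    (z := T.gH.mul (T.vB.src X) (T.vB.src (T.hB.mul Q W))) ?_
  rw [← hXY.mul_vmul_above hZY hlZ, hQ, GroupoidOn.mul_assoc hXQ hQW, h.mul_eq]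

section Algebra

variable [Fintype B] [Fintype H] {k : Type*} [Field k] (ϑ : P → kˣ)

open Classical in
/-- `Δ(1)` is the weighted sum of all factorizations of vertical identities. -/
theorem comul_one : Coalgebra.comul (R := k) (1 : T.Alg k ϑ) =
    ∑ p with T.IsVidFactorization p,
      (ϑ (T.lb p.2) : k) • (T.box k ϑ p.1 ⊗ₜ[k] T.box k ϑ p.2) := by
  simp only [one_def, map_sum, comul_box]
  rw [← Finset.sum_fiberwise (s := Finset.univ.filter T.IsVidFactorization)
    (g := fun p => T.vB.src (T.hB.mul p.1 p.2))]
  refine Finset.sum_congr rfl fun x _ => Finset.sum_congr ?_ fun _ _ => rfl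
  ext p
  simp only [mem_horFactorizations_iff, Finset.mem_filter, Finset.mem_univ, true_and]
  constructor
  · rintro ⟨h, e⟩
    exact ⟨⟨h, x, e⟩, by rw [e, src_id]⟩
  · rintro ⟨⟨h, y, e⟩, hx⟩
    rw [e, src_id] at hx
    exact ⟨h, by rw [e, hx]⟩

open Classical in
theorem comul_comul_one_eq_sum :
    LinearMap.lTensor _ (Coalgebra.comul (R := k)) (Coalgebra.comul (R := k) (1 : T.Alg k ϑ)) =
      ∑ q ∈ (Finset.univ.filter T.IsVidFactorization).sigma fun p => T.horFactorizations p.2,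
        ((ϑ (T.lb q.1.2) : k) * ϑ (T.lb q.2.2)) •
          (T.box k ϑ q.1.1 ⊗ₜ[k] (T.box k ϑ q.2.1 ⊗ₜ[k] T.box k ϑ q.2.2)) := by
  rw [comul_one, map_sum, Finset.sum_sigma]
  refine Finset.sum_congr rfl fun p _ => ?_
  rw [map_smul, LinearMap.lTensor_tmul, comul_box, TensorProduct.tmul_sum, Finset.smul_sum]
  refine Finset.sum_congr rfl fun q _ => ?_
  rw [TensorProduct.tmul_smul, smul_smul]

/-- `Δ²(1) = (Δ(1) ⊗ 1)(1 ⊗ Δ(1))`. -/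
theorem comul_comul_one_eq_below :
    LinearMap.lTensor _ (Coalgebra.comul (R := k)) (Coalgebra.comul (R := k) (1 : T.Alg k ϑ)) =
      TensorProduct.assoc k _ _ _ (Coalgebra.comul (R := k) (1 : T.Alg k ϑ) ⊗ₜ[k] 1) *
        (1 ⊗ₜ[k] Coalgebra.comul (R := k) (1 : T.Alg k ϑ)) := by
  classical
  rw [comul_comul_one_eq_sum]
  have hR : TensorProduct.assoc k _ _ _ (Coalgebra.comul (R := k) (1 : T.Alg k ϑ) ⊗ₜ[k] 1) *
        (1 ⊗ₜ[k] Coalgebra.comul (R := k) (1 : T.Alg k ϑ)) =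
      ∑ p ∈ Finset.univ.filter T.IsVidFactorization ×ˢ Finset.univ.filter T.IsVidFactorization with
        T.vB.tgt p.1.2 = T.vB.src p.2.1, ((ϑ (T.lb p.1.2) : k) * ϑ (T.lb p.2.2)) •
        (T.box k ϑ p.1.1 ⊗ₜ[k] (T.box k ϑ (T.vB.mul p.1.2 p.2.1) ⊗ₜ[k] T.box k ϑ p.2.2)) := by
    rw [comul_one, assoc_sum_tmul_one_mul, Finset.sum_filter]
    refine Finset.sum_congr rfl fun p _ => ?_
    rw [box_mul]
    split_ifs <;> simp
  rw [hR]
  symm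
  refine Finset.sum_bij'
    (fun p _ => ⟨(p.1.1, T.hB.mul (T.vB.mul p.1.2 p.2.1) p.2.2),
      (T.vB.mul p.1.2 p.2.1, p.2.2)⟩)
    (fun q _ =>
      let Y := T.hB.mul (T.hB.inv q.1.1) (T.vB.id (T.gH.mul (T.vB.src q.1.1) (T.vB.src q.2.1)))
      ((q.1.1, Y), (T.vB.mul (T.vB.inv Y) q.2.1, q.2.2))) ?_ ?_ ?_ ?_ ?_
  · rintro ⟨⟨X, Y⟩, ⟨Z, W⟩⟩ hp
    simp only [Finset.mem_filter, Finset.mem_product, mem_horFactorizations_iff,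
      Finset.mem_sigma, Finset.mem_univ, true_and] at hp ⊢
    obtain ⟨⟨hXY, hZW⟩, hYZ⟩ := hp
    obtain ⟨-, h₂, h₃⟩ := hXY.glue_below hZW hYZ
    exact ⟨h₃, h₂, trivial⟩
  · rintro ⟨⟨X, R⟩, ⟨Q, W⟩⟩ hq
    simp only [Finset.mem_filter, Finset.mem_product, mem_horFactorizations_iff,
      Finset.mem_sigma, Finset.mem_univ, true_and] at hq ⊢
    obtain ⟨h, hQW, rfl⟩ := hq
    obtain ⟨h₁, h₂, h₃, -⟩ := h.cut_below hQW rfl rfl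
    exact ⟨⟨h₁, h₂⟩, h₃⟩
  · rintro ⟨⟨X, Y⟩, ⟨Z, W⟩⟩ hp
    simp only [Finset.mem_filter, Finset.mem_product, Finset.mem_univ, true_and] at hp
    obtain ⟨⟨hXY, hZW⟩, hYZ⟩ := hp
    simp only [src_mul hYZ, ← hXY.eq_inv_mul, inv_mul_cancel_left hYZ]
  · rintro ⟨⟨X, R⟩, ⟨Q, W⟩⟩ hq
    simp only [Finset.mem_filter, mem_horFactorizations_iff, Finset.mem_sigma, Finset.mem_univ,
      true_and] at hq
    obtain ⟨h, hQW, rfl⟩ := hq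
    obtain ⟨-, -, -, h₄⟩ := h.cut_below hQW rfl rfl
    simp only [h₄]
  · rintro ⟨⟨X, Y⟩, ⟨Z, W⟩⟩ hp
    simp only [Finset.mem_filter, Finset.mem_product, Finset.mem_univ, true_and] at hp
    obtain ⟨⟨hXY, hZW⟩, hYZ⟩ := hp
    have hQW := (hXY.glue_below hZW hYZ).2.1
    -- The weights agree because the left side of `Z` is an identity.
    have : T.lb (T.hB.mul (T.vB.mul Y Z) W) = T.lb Y := by
      rw [← T.hB.comp_eq_mul hQW, lb_of_comp]
      simp only [lb, bot, tgt_mul hYZ]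
      rw [hYZ, T.corner_lb, T.corner_lt, hZW.src_eq, tgt_id, src_id]
    simp only [this]

/-- `Δ²(1) = (1 ⊗ Δ(1))(Δ(1) ⊗ 1)`. -/
theorem comul_comul_one_eq_above :
    LinearMap.lTensor _ (Coalgebra.comul (R := k)) (Coalgebra.comul (R := k) (1 : T.Alg k ϑ)) =
      (1 ⊗ₜ[k] Coalgebra.comul (R := k) (1 : T.Alg k ϑ)) *
        TensorProduct.assoc k _ _ _ (Coalgebra.comul (R := k) (1 : T.Alg k ϑ) ⊗ₜ[k] 1) := by
  classical
  rw [comul_comul_one_eq_sum]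
  have hR : (1 ⊗ₜ[k] Coalgebra.comul (R := k) (1 : T.Alg k ϑ)) *
        TensorProduct.assoc k _ _ _ (Coalgebra.comul (R := k) (1 : T.Alg k ϑ) ⊗ₜ[k] 1) =
      ∑ p ∈ Finset.univ.filter T.IsVidFactorization ×ˢ Finset.univ.filter T.IsVidFactorization with
        T.vB.tgt p.2.1 = T.vB.src p.1.2, ((ϑ (T.lb p.1.2) : k) * ϑ (T.lb p.2.2)) •
        (T.box k ϑ p.1.1 ⊗ₜ[k] (T.box k ϑ (T.vB.mul p.2.1 p.1.2) ⊗ₜ[k] T.box k ϑ p.2.2)) := by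
    rw [comul_one, one_tmul_mul_assoc_sum, Finset.sum_filter]
    refine Finset.sum_congr rfl fun p _ => ?_
    rw [box_mul]
    split_ifs <;> simp
  rw [hR]
  symm
  refine Finset.sum_bij'
    (fun p _ => ⟨(p.1.1, T.hB.mul (T.vB.mul p.2.1 p.1.2) p.2.2),
      (T.vB.mul p.2.1 p.1.2, p.2.2)⟩)
    (fun q _ =>
      let Y := T.hB.mul (T.hB.inv q.1.1) (T.vB.id (T.gH.mul (T.vB.tgt q.1.1) (T.vB.tgt q.2.1)))
      ((q.1.1, Y), (T.vB.mul q.2.1 (T.vB.inv Y), q.2.2))) ?_ ?_ ?_ ?_ ?_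
  · rintro ⟨⟨X, Y⟩, ⟨Z, W⟩⟩ hp
    simp only [Finset.mem_filter, Finset.mem_product, mem_horFactorizations_iff,
      Finset.mem_sigma, Finset.mem_univ, true_and] at hp ⊢
    obtain ⟨⟨hXY, hZW⟩, hZY⟩ := hp
    obtain ⟨-, h₂, h₃⟩ := hXY.glue_above hZW hZY
    exact ⟨h₃, h₂, trivial⟩
  · rintro ⟨⟨X, R⟩, ⟨Q, W⟩⟩ hq
    simp only [Finset.mem_filter, Finset.mem_product, mem_horFactorizations_iff,
      Finset.mem_sigma, Finset.mem_univ, true_and] at hq ⊢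
    obtain ⟨h, hQW, rfl⟩ := hq
    obtain ⟨h₁, h₂, h₃, -⟩ := h.cut_above hQW rfl rfl
    exact ⟨⟨h₁, h₂⟩, h₃⟩
  · rintro ⟨⟨X, Y⟩, ⟨Z, W⟩⟩ hp
    simp only [Finset.mem_filter, Finset.mem_product, Finset.mem_univ, true_and] at hp
    obtain ⟨⟨hXY, hZW⟩, hZY⟩ := hp
    simp only [tgt_mul hZY, ← hXY.eq_inv_mul', mul_inv_cancel_right hZY]
  · rintro ⟨⟨X, R⟩, ⟨Q, W⟩⟩ hq
    simp only [Finset.mem_filter, mem_horFactorizations_iff, Finset.mem_sigma, Finset.mem_univ,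
      true_and] at hq
    obtain ⟨h, hQW, rfl⟩ := hq
    obtain ⟨-, -, -, h₄⟩ := h.cut_above hQW rfl rfl
    simp only [h₄]
  · rintro ⟨⟨X, Y⟩, ⟨Z, W⟩⟩ hp
    simp only [Finset.mem_filter, Finset.mem_product, Finset.mem_univ, true_and] at hp
    obtain ⟨⟨hXY, hZW⟩, hZY⟩ := hp
    have hQW := (hXY.glue_above hZW hZY).2.1
    have : T.lb (T.hB.mul (T.vB.mul Z Y) W) = T.lb Y := by
      rw [← T.hB.comp_eq_mul hQW, lb_of_comp]
      simp only [lb, bot, tgt_mul hZY]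
    simp only [this]

end Algebra

end DoubleGroupoid

namespace DoubleGroupoid

open GroupoidOn

variable {B H V P : Type*} (T : DoubleGroupoid B H V P)

/-! ### The antipode -/

/-- The horizontal identity of the left side of `A`, stacked on `A⁻¹`. It is defined when the
bottom side of `A` is an identity, and is then the part of `ε_t(A)` that depends on `A`. -/
noncomputable def targetBox (A : B) : B := T.vB.mul (T.hB.id (T.hB.src A)) (T.boxInv A)

/-- The inverse `A⁻¹` stacked on the horizontal identity of the right side of `A`. It is defined
when the top side of `A` is an identity, and is then the part of `ε_s(A)` that depends on `A`. -/
noncomputable def sourceBox (A : B) : B := T.vB.mul (T.boxInv A) (T.hB.id (T.hB.tgt A))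

variable {T} {A X Y : B}

theorem vsrc_boxInv : T.vB.src (T.boxInv A) = T.gH.inv (T.vB.tgt A) := by
  rw [boxInv, src_inv, T.tgt_hinv]

theorem vtgt_boxInv : T.vB.tgt (T.boxInv A) = T.gH.inv (T.vB.src A) := by
  rw [boxInv, tgt_inv, T.src_hinv]

theorem hsrc_boxInv : T.hB.src (T.boxInv A) = T.gV.inv (T.hB.tgt A) := by
  rw [boxInv, T.src_vinv, src_inv]

theorem htgt_boxInv : T.hB.tgt (T.boxInv A) = T.gV.inv (T.hB.src A) := by
  rw [boxInv, T.tgt_vinv, tgt_inv]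

theorem boxInv_hmul (h : T.hB.tgt X = T.hB.src Y) :
    T.boxInv (T.hB.mul X Y) = T.hB.mul (T.boxInv Y) (T.boxInv X) := by
  rw [boxInv, inv_mul_rev h, T.vinv_hmul (by rw [tgt_inv, src_inv, h])]
  rfl

theorem hinv_boxInv : T.hB.inv (T.boxInv A) = T.vB.inv A := by
  rw [boxInv, T.hinv_vinv, GroupoidOn.inv_inv]

theorem boxInv_hinv : T.boxInv (T.hB.inv A) = T.vB.inv A := by
  rw [boxInv, GroupoidOn.inv_inv]

/-- For a product `A = XY` the box `X` can be stacked on `Y⁻¹` exactly when the bottom of `A` is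
an identity. -/
theorem vtgt_eq_vsrc_boxInv_iff (h : T.hB.tgt X = T.hB.src Y) (e : T.hB.mul X Y = A) :
    T.vB.tgt X = T.vB.src (T.boxInv Y) ↔ T.vB.tgt A = T.gH.id (T.gH.src (T.vB.tgt A)) := by
  have hc := T.tgt_tgt_composable h
  rw [← e, T.tgt_hmul h, src_mul hc, mul_eq_id_iff hc, vsrc_boxInv]
  constructor
  · intro h; rw [h, GroupoidOn.inv_inv]
  · intro h; rw [h, GroupoidOn.inv_inv]

/-- For a product `A = XY` the box `X⁻¹` can be stacked on `Y` exactly when the top of `A` is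
an identity. -/
theorem vtgt_boxInv_eq_vsrc_iff (h : T.hB.tgt X = T.hB.src Y) (e : T.hB.mul X Y = A) :
    T.vB.tgt (T.boxInv X) = T.vB.src Y ↔ T.vB.src A = T.gH.id (T.gH.src (T.vB.src A)) := by
  have hc := T.tgt_src_composable h
  rw [← e, T.src_hmul h, src_mul hc, mul_eq_id_iff hc, vtgt_boxInv, eq_comm]

theorem vtgt_hid_eq_vsrc_boxInv {p : P} (hA : T.vB.tgt A = T.gH.id p) :
    T.vB.tgt (T.hB.id (T.hB.src A)) = T.vB.src (T.boxInv A) := by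
  rw [T.bot_hid, vsrc_boxInv, ← T.corner_lb, hA, src_id, inv_id]

theorem vtgt_boxInv_eq_vsrc_hid {p : P} (hA : T.vB.src A = T.gH.id p) :
    T.vB.tgt (T.boxInv A) = T.vB.src (T.hB.id (T.hB.tgt A)) := by
  rw [T.top_hid, vtgt_boxInv, ← T.corner_rt, hA, tgt_id, inv_id]

theorem vmul_boxInv_right (h : T.hB.tgt X = T.hB.src Y) (e : T.hB.mul X Y = A) {p : P}
    (hA : T.vB.tgt A = T.gH.id p) :
    T.vB.mul X (T.boxInv Y) = T.hB.mul (T.targetBox A) (T.vB.id (T.vB.src X)) := by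
  have hY : Y = T.hB.mul (T.hB.inv X) A := by rw [← e, inv_mul_cancel_left h]
  have hX : T.hB.src X = T.hB.src A := by rw [← e, src_mul h]
  have hXA : T.hB.tgt (T.hB.inv X) = T.hB.src A := by rw [tgt_inv, hX]
  have hI : T.boxInv Y = T.hB.mul (T.boxInv A) (T.vB.inv X) := by
    rw [hY, boxInv_hmul hXA, boxInv_hinv]
  have h₁ : T.hB.tgt (T.boxInv A) = T.hB.src (T.vB.inv X) := by
    rw [htgt_boxInv, T.src_vinv, hX]
  conv_lhs => rw [← id_mul (𝒢 := T.hB) (f := X) hX, hI]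
  rw [T.hinterchange (by rw [tgt_id, hX]) h₁ (vtgt_hid_eq_vsrc_boxInv hA) (src_inv _ _).symm,
    GroupoidOn.mul_inv]
  rfl

theorem vmul_boxInv_left (h : T.hB.tgt X = T.hB.src Y) (e : T.hB.mul X Y = A) {p : P}
    (hA : T.vB.src A = T.gH.id p) :
    T.vB.mul (T.boxInv X) Y = T.hB.mul (T.vB.id (T.vB.tgt Y)) (T.sourceBox A) := by
  have hX : X = T.hB.mul A (T.hB.inv Y) := by rw [← e, mul_inv_cancel_right h]
  have hY : T.hB.tgt Y = T.hB.tgt A := by rw [← e, tgt_mul h]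
  have hYA : T.hB.tgt A = T.hB.src (T.hB.inv Y) := by rw [src_inv, hY]
  have hI : T.boxInv X = T.hB.mul (T.vB.inv Y) (T.boxInv A) := by
    rw [hX, boxInv_hmul hYA, boxInv_hinv]
  have h₁ : T.hB.tgt (T.vB.inv Y) = T.hB.src (T.boxInv A) := by
    rw [hsrc_boxInv, T.tgt_vinv, hY]
  conv_lhs => rw [← mul_id (𝒢 := T.hB) (f := Y) hY, hI]
  rw [T.hinterchange h₁ (by rw [src_id, hY]) (tgt_inv _ _) (vtgt_boxInv_eq_vsrc_hid hA),
    GroupoidOn.inv_mul]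
  rfl

theorem htgt_targetBox {p : P} (hA : T.vB.tgt A = T.gH.id p) :
    T.hB.tgt (T.targetBox A) = T.gV.id (T.gH.src (T.vB.src A)) := by
  rw [targetBox, T.tgt_vmul (vtgt_hid_eq_vsrc_boxInv hA), tgt_id, htgt_boxInv, GroupoidOn.mul_inv,
    T.corner_lt]

theorem vsrc_hmul_targetBox_vid {p : P} (hA : T.vB.tgt A = T.gH.id p) {x : H}
    (hx : T.gH.src x = T.gH.src (T.vB.src A)) :
    T.vB.src (T.hB.mul (T.targetBox A) (T.vB.id x)) = x := by
  rw [T.src_hmul (by rw [htgt_targetBox hA, T.left_vid, hx]), targetBox,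
    src_mul (vtgt_hid_eq_vsrc_boxInv hA), T.top_hid, src_id, id_mul]
  rw [hx, T.corner_lt]

/-- The box identity behind `S(h₁) h₂ S(h₃) = S(h)`. -/
theorem vmul_boxInv_targetBox (h : T.hB.tgt X = T.hB.src Y) (e : T.hB.mul X Y = A) {p : P}
    (hY : T.vB.tgt Y = T.gH.id p) :
    T.vB.tgt (T.boxInv X) =
      T.vB.src (T.hB.mul (T.targetBox Y) (T.vB.id (T.gH.inv (T.vB.src X)))) ∧
    T.vB.mul (T.boxInv X) (T.hB.mul (T.targetBox Y) (T.vB.id (T.gH.inv (T.vB.src X)))) =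
      T.boxInv A := by
  have h₀ := vtgt_hid_eq_vsrc_boxInv hY
  have hx : T.gH.src (T.gH.inv (T.vB.src X)) = T.gH.src (T.vB.src Y) := by
    rw [src_inv, T.tgt_src_composable h]
  have h₁ : T.hB.tgt (T.targetBox Y) = T.hB.src (T.vB.id (T.gH.inv (T.vB.src X))) := by
    rw [htgt_targetBox hY, T.left_vid, hx]
  have h₂ : T.vB.src (T.targetBox Y) = T.gH.id (T.gH.tgt (T.vB.src X)) := by
    rw [targetBox, src_mul h₀, T.top_hid, T.corner_rt, h]
  have h₃ : T.vB.tgt (T.boxInv X) = T.vB.src (T.vB.id (T.gH.inv (T.vB.src X))) := by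
    rw [src_id, vtgt_boxInv]
  have h₄ : T.vB.tgt (T.hB.id (T.hB.src (T.boxInv X))) = T.vB.src (T.targetBox Y) := by
    rw [h₂, T.bot_hid, hsrc_boxInv, tgt_inv, T.corner_rt]
  have h₅ : T.hB.tgt (T.hB.id (T.hB.src (T.boxInv X))) = T.hB.src (T.boxInv X) := tgt_id _ _
  refine ⟨?_, ?_⟩
  · rw [vsrc_hmul_targetBox_vid hY hx, vtgt_boxInv]
  · conv_lhs => rw [← id_mul (𝒢 := T.hB) (f := T.boxInv X) rfl]
    rw [T.hinterchange h₅ h₁ h₄ h₃, mul_id (by rw [h₃, src_id]), targetBox, hsrc_boxInv,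
      ← GroupoidOn.mul_assoc (by rw [T.bot_hid, T.top_hid, tgt_inv, h]) h₀,
      T.vmul_hid (by rw [tgt_inv, h]), h, GroupoidOn.inv_mul, ← T.vid_id,
      id_mul (by rw [← h₀, T.bot_hid]), ← boxInv_hmul h, e]

/-- The factorizations of vertical identities that contribute to `ε_t(A)`: if `X / A` is a
horizontal identity, then the bottom of `A` is an identity and `X` is determined by `A`. -/
theorem IsVidFactorization.eq_of_vmul_eq_hid (h : T.IsVidFactorization (X, Y))
    (hXA : T.vB.tgt X = T.vB.src A)
    (e : T.vB.mul X A = T.hB.id (T.hB.src (T.vB.mul X A))) :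
    T.vB.tgt A = T.gH.id (T.gH.src (T.vB.tgt A)) ∧
      X = T.vB.mul (T.hB.id (T.hB.src A)) (T.vB.inv A) := by
  have hl : T.hB.src (T.vB.mul X A) = T.hB.src A := by
    rw [T.src_vmul hXA, h.src_eq, id_mul]
    rw [← T.corner_lt, ← hXA, T.corner_lb, h.src_eq, tgt_id]
  rw [hl] at e
  constructor
  · rw [T.corner_lb, ← T.bot_hid, ← e, tgt_mul hXA]
  · rw [← e, mul_inv_cancel_right hXA]

/-- The factorizations of vertical identities that contribute to `ε_s(A)`: if `A / Y` is a
horizontal identity, then the top of `A` is an identity and `Y` is determined by `A`. -/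
theorem IsVidFactorization.eq_of_vmul_eq_hid' (h : T.IsVidFactorization (X, Y))
    (hAY : T.vB.tgt A = T.vB.src Y)
    (e : T.vB.mul A Y = T.hB.id (T.hB.src (T.vB.mul A Y))) :
    T.vB.src A = T.gH.id (T.gH.src (T.vB.src A)) ∧
      Y = T.vB.mul (T.vB.inv A) (T.hB.id (T.hB.tgt A)) := by
  have hr : T.hB.tgt (T.vB.mul A Y) = T.hB.tgt A := by
    rw [T.tgt_vmul hAY, h.tgt_eq, mul_id]
    rw [← hAY, T.corner_rb]
  have hlr : T.hB.src (T.vB.mul A Y) = T.hB.tgt A := by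
    rw [← hr]
    conv_rhs => rw [e, tgt_id]
  constructor
  · rw [T.corner_lt, ← T.top_hid, ← src_mul hAY]
    conv_lhs => rw [e]
    rw [T.top_hid, T.top_hid, T.src_vmul hAY, src_mul]
    rw [← T.corner_lb, ← T.corner_lt, hAY]
  · rw [← hlr, ← e, inv_mul_cancel_left hAY]

section Algebra

variable [Fintype B] [Fintype H] {k : Type*} [Field k] {ϑ : P → kˣ}

open Classical in
/-- The value of `A₁ S(A₂)`. The product of `X` and `Y⁻¹`, for `XY = A`, depends on `X` only through
its top side `x`, so that the weights of all `X` with the same `x` can be added up. -/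
theorem mul_lTensor_antipode_comul_box (hϑ : T.IsCornerFunction k ϑ) (A : B) :
    LinearMap.mul' k (T.Alg k ϑ) (LinearMap.lTensor _ (T.antipode k ϑ)
      (Coalgebra.comul (R := k) (T.box k ϑ A))) =
    if T.vB.tgt A = T.gH.id (T.gH.src (T.vB.tgt A)) then
      ((ϑ (T.rt A) : k) / ϑ (T.rb A)) •
        ∑ x with T.gH.src x = T.lt A, T.box k ϑ (T.hB.mul (T.targetBox A) (T.vB.id x))
    else 0 := by
  have hterm : ∀ p ∈ T.horFactorizations A,
      LinearMap.mul' k (T.Alg k ϑ) (LinearMap.lTensor _ (T.antipode k ϑ)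
        ((ϑ (T.lb p.2) : k) • (T.box k ϑ p.1 ⊗ₜ[k] T.box k ϑ p.2))) =
      if T.vB.tgt A = T.gH.id (T.gH.src (T.vB.tgt A)) then
        ((ϑ (T.rb p.1) : k) * ((ϑ (T.rt A) : k) / ϑ (T.rb A))) •
          T.box k ϑ (T.hB.mul (T.targetBox A) (T.vB.id (T.vB.src p.1)))
      else 0 := by
    rintro ⟨X, Y⟩ hp
    obtain ⟨h, e⟩ := T.mem_horFactorizations_iff.1 hp
    simp only at h e ⊢
    have h₁ : T.lb Y = T.rb X := (T.tgt_tgt_composable h).symm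
    have h₂ : T.rt Y = T.rt A := by
      simp only [rt, top]; rw [T.corner_rt, T.corner_rt, ← e, tgt_mul h]
    have h₃ : T.rb Y = T.rb A := by
      simp only [rb, bot]; rw [T.corner_rb, T.corner_rb, ← e, tgt_mul h]
    rw [map_smul, map_smul, LinearMap.lTensor_tmul, LinearMap.mul'_apply, antipode_box,
      mul_smul_comm, smul_smul, h₁, h₂, h₃, box_mul]
    simp only [vtgt_eq_vsrc_boxInv_iff h e]
    split_ifs with hA
    · rw [vmul_boxInv_right h e hA]
    · rw [smul_zero]
  rw [comul_box, map_sum, map_sum, Finset.sum_congr rfl hterm]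
  split_ifs with hA
  · rw [sum_horFactorizations_left, Finset.smul_sum,
      ← Finset.sum_fiberwise_of_maps_to (t := Finset.univ.filter fun x => T.gH.src x = T.lt A)
        (g := T.vB.src)]
    · refine Finset.sum_congr rfl fun x hx => ?_
      simp only [Finset.mem_filter, Finset.mem_univ, true_and] at hx
      have hx' : T.gV.src (T.hB.src A) = T.gH.src x := by
        rw [hx, ← T.corner_lt]; rfl
      rw [Finset.filter_filter]
      simp only [and_comm (a := T.hB.src _ = _)]
      rw [Finset.sum_congr rfl fun X hX => by
        rw [((Finset.mem_filter.1 hX).2).1], ← Finset.sum_smul, ← Finset.sum_mul,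
        hϑ.sum_top_left hx', one_mul]
    · intro X hX
      simp only [Finset.mem_filter, Finset.mem_univ, true_and] at hX ⊢
      simp only [lt, top]
      rw [T.corner_lt, T.corner_lt, hX]
  · exact Finset.sum_const_zero

open Classical in
/-- The value of `S(A₁) A₂`. The product of `X⁻¹` and `Y`, for `XY = A`, depends on `Y` only through
its bottom side `y`, so that the weights of all `Y` with the same `y` can be added up. -/
theorem mul_rTensor_antipode_comul_box (hϑ : T.IsCornerFunction k ϑ) (A : B) :
    LinearMap.mul' k (T.Alg k ϑ) (LinearMap.rTensor _ (T.antipode k ϑ)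
      (Coalgebra.comul (R := k) (T.box k ϑ A))) =
    if T.vB.src A = T.gH.id (T.gH.src (T.vB.src A)) then
      ∑ y with T.gH.tgt y = T.rb A, T.box k ϑ (T.hB.mul (T.vB.id y) (T.sourceBox A))
    else 0 := by
  have hterm : ∀ p ∈ T.horFactorizations A,
      LinearMap.mul' k (T.Alg k ϑ) (LinearMap.rTensor _ (T.antipode k ϑ)
        ((ϑ (T.lb p.2) : k) • (T.box k ϑ p.1 ⊗ₜ[k] T.box k ϑ p.2))) =
      if T.vB.src A = T.gH.id (T.gH.src (T.vB.src A)) then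
        (ϑ (T.lt p.2) : k) • T.box k ϑ (T.hB.mul (T.vB.id (T.vB.tgt p.2)) (T.sourceBox A))
      else 0 := by
    rintro ⟨X, Y⟩ hp
    obtain ⟨h, e⟩ := T.mem_horFactorizations_iff.1 hp
    simp only at h e ⊢
    have h₁ : T.rb X = T.lb Y := T.tgt_tgt_composable h
    have h₂ : T.rt X = T.lt Y := T.tgt_src_composable h
    rw [map_smul, map_smul, LinearMap.rTensor_tmul, LinearMap.mul'_apply, antipode_box,
      smul_mul_assoc, smul_smul, h₁, h₂, mul_div_cancel₀ _ (ϑ _).ne_zero, box_mul]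
    simp only [vtgt_boxInv_eq_vsrc_iff h e]
    split_ifs with hA
    · rw [vmul_boxInv_left h e hA]
    · rw [smul_zero]
  rw [comul_box, map_sum, map_sum, Finset.sum_congr rfl hterm]
  split_ifs with hA
  · rw [sum_horFactorizations_right,
      ← Finset.sum_fiberwise_of_maps_to (t := Finset.univ.filter fun y => T.gH.tgt y = T.rb A)
        (g := T.vB.tgt)]
    · refine Finset.sum_congr rfl fun y hy => ?_
      simp only [Finset.mem_filter, Finset.mem_univ, true_and] at hy
      have hy' : T.gV.tgt (T.hB.tgt A) = T.gH.tgt y := by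
        rw [hy, ← T.corner_rb]; rfl
      rw [Finset.filter_filter]
      simp only [and_comm (a := T.hB.tgt _ = _)]
      rw [Finset.sum_congr rfl fun Y hY => by
        rw [((Finset.mem_filter.1 hY).2).1], ← Finset.sum_smul,
        hϑ.sum_bot_right hy', one_smul]
    · intro Y hY
      simp only [Finset.mem_filter, Finset.mem_univ, true_and] at hY ⊢
      simp only [rb, bot]
      rw [T.corner_rb, T.corner_rb, hY]
  · exact Finset.sum_const_zero

open Classical in
/-- The value of `ε_t(A)`, which agrees with that of `A₁ S(A₂)`. -/
theorem weakTarget_box (A : B) :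
    weakTarget k (T.box k ϑ A) =
    if T.vB.tgt A = T.gH.id (T.gH.src (T.vB.tgt A)) then
      ((ϑ (T.rt A) : k) / ϑ (T.rb A)) •
        ∑ x with T.gH.src x = T.lt A, T.box k ϑ (T.hB.mul (T.targetBox A) (T.vB.id x))
    else 0 := by
  have hsum : weakTarget k (T.box k ϑ A) =
      ∑ p : B × B with T.IsVidFactorization p ∧ T.vB.tgt p.1 = T.vB.src A ∧
          T.vB.mul p.1 A = T.hB.id (T.hB.src (T.vB.mul p.1 A)),
        ((ϑ (T.lb p.2) : k) * (ϑ (T.lb (T.vB.mul p.1 A)) : k)⁻¹) • T.box k ϑ p.2 := by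
    rw [weakTarget, comul_one, Finset.sum_mul, map_sum, map_sum, ← Finset.filter_filter,
      Finset.sum_filter (s := Finset.univ.filter T.IsVidFactorization)]
    refine Finset.sum_congr rfl fun p _ => ?_
    rw [smul_mul_assoc, map_smul, map_smul, Algebra.TensorProduct.tmul_mul_tmul, mul_one,
      LinearMap.rTensor_tmul, TensorProduct.lid_tmul, box_mul]
    by_cases h₁ : T.vB.tgt p.1 = T.vB.src A
    · by_cases h₂ : T.vB.mul p.1 A = T.hB.id (T.hB.src (T.vB.mul p.1 A))
      · rw [if_pos h₁, if_pos ⟨h₁, h₂⟩, counit_box, if_pos h₂, smul_smul]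
      · rw [if_pos h₁, if_neg (fun h => h₂ h.2), counit_box, if_neg h₂, zero_smul, smul_zero]
    · rw [if_neg h₁, if_neg (fun h => h₁ h.1), map_zero, zero_smul, smul_zero]
  rw [hsum]
  split_ifs with hA
  · have h₀ : T.vB.tgt (T.hB.id (T.hB.src A)) = T.vB.src (T.vB.inv A) := by
      rw [T.bot_hid, src_inv, ← T.corner_lb, ← hA]
    have hX : T.hB.src (T.vB.mul (T.hB.id (T.hB.src A)) (T.vB.inv A)) =
        T.gV.id (T.gH.src (T.vB.src A)) := by
      rw [T.src_vmul h₀, src_id, T.src_vinv, GroupoidOn.mul_inv, T.corner_lt]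
    have hXA : T.vB.tgt (T.vB.mul (T.hB.id (T.hB.src A)) (T.vB.inv A)) = T.vB.src A := by
      rw [tgt_mul h₀, tgt_inv]
    have hmul : T.vB.mul (T.vB.mul (T.hB.id (T.hB.src A)) (T.vB.inv A)) A =
        T.hB.id (T.hB.src A) := inv_mul_cancel_right (by rw [h₀, src_inv])
    have hinv : T.hB.inv (T.vB.mul (T.hB.id (T.hB.src A)) (T.vB.inv A)) = T.targetBox A := by
      rw [T.hinv_vmul h₀, inv_id, T.hinv_vinv]
      rfl
    rw [Finset.smul_sum]
    refine Finset.sum_bij' (fun p _ => T.vB.src (T.hB.mul p.1 p.2))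
      (fun x _ => (T.vB.mul (T.hB.id (T.hB.src A)) (T.vB.inv A),
        T.hB.mul (T.targetBox A) (T.vB.id x))) ?_ ?_ ?_ ?_ ?_
    · rintro ⟨X, Y⟩ hp
      simp only [Finset.mem_filter, Finset.mem_univ, true_and] at hp ⊢
      obtain ⟨h, h₁, h₂⟩ := hp
      obtain ⟨-, rfl⟩ := h.eq_of_vmul_eq_hid h₁ h₂
      rw [T.src_hmul h.1, src_mul (T.tgt_src_composable h.1), src_mul h₀, T.top_hid, src_id,
        ← T.corner_lt]
      rfl
    · intro x hx
      simp only [Finset.mem_filter, Finset.mem_univ, true_and] at hx ⊢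
      refine ⟨?_, hXA, by rw [hmul, src_id]⟩
      rw [← hinv]
      exact isVidFactorization_of_src hX hx
    · rintro ⟨X, Y⟩ hp
      simp only [Finset.mem_filter, Finset.mem_univ, true_and] at hp
      obtain ⟨h, h₁, h₂⟩ := hp
      obtain ⟨-, rfl⟩ := h.eq_of_vmul_eq_hid h₁ h₂
      simp only [← hinv, T.src_hmul h.1, ← h.eq_inv_mul]
    · intro x hx
      simp only [Finset.mem_filter, Finset.mem_univ, true_and] at hx
      simp only [← hinv]
      rw [mul_inv_cancel_left, src_id]
      rw [hX, T.left_vid, hx]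
      rfl
    · rintro ⟨X, Y⟩ hp
      simp only [Finset.mem_filter, Finset.mem_univ, true_and] at hp
      obtain ⟨h, h₁, h₂⟩ := hp
      obtain ⟨-, rfl⟩ := h.eq_of_vmul_eq_hid h₁ h₂
      have e₁ : T.lb Y = T.rt A := by
        simp only [lb, rt, bot, top]
        rw [← T.tgt_tgt_composable h.1, hXA]
      have e₂ : T.lb (T.hB.id (T.hB.src A)) = T.rb A := by
        simp only [lb, rb, bot]
        rw [T.bot_hid, src_id, ← T.corner_lb, hA, tgt_id, src_id]
      simp only [hmul, e₁, e₂, ← hinv, T.src_hmul h.1, ← h.eq_inv_mul, div_eq_mul_inv]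
  · rw [Finset.filter_false_of_mem, Finset.sum_empty]
    rintro ⟨X, Y⟩ - ⟨h, h₁, h₂⟩
    exact hA (h.eq_of_vmul_eq_hid h₁ h₂).1

open Classical in
/-- The value of `ε_s(A)`, which agrees with that of `S(A₁) A₂`. -/
theorem weakSource_box (A : B) :
    weakSource k (T.box k ϑ A) =
    if T.vB.src A = T.gH.id (T.gH.src (T.vB.src A)) then
      ∑ y with T.gH.tgt y = T.rb A, T.box k ϑ (T.hB.mul (T.vB.id y) (T.sourceBox A))
    else 0 := by
  have hsum : weakSource k (T.box k ϑ A) =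
      ∑ p : B × B with T.IsVidFactorization p ∧ T.vB.tgt A = T.vB.src p.2 ∧
          T.vB.mul A p.2 = T.hB.id (T.hB.src (T.vB.mul A p.2)), T.box k ϑ p.1 := by
    rw [weakSource, comul_one, Finset.mul_sum, map_sum, map_sum, ← Finset.filter_filter,
      Finset.sum_filter (s := Finset.univ.filter T.IsVidFactorization)]
    refine Finset.sum_congr rfl fun p _ => ?_
    rw [mul_smul_comm, map_smul, map_smul, Algebra.TensorProduct.tmul_mul_tmul, one_mul,
      LinearMap.lTensor_tmul, TensorProduct.rid_tmul, box_mul]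
    by_cases h₁ : T.vB.tgt A = T.vB.src p.2
    · by_cases h₂ : T.vB.mul A p.2 = T.hB.id (T.hB.src (T.vB.mul A p.2))
      · have e : T.lb (T.vB.mul A p.2) = T.lb p.2 := by simp only [lb, bot, tgt_mul h₁]
        rw [if_pos h₁, if_pos ⟨h₁, h₂⟩, counit_box, if_pos h₂, smul_smul, e,
          mul_inv_cancel₀ (ϑ _).ne_zero, one_smul]
      · rw [if_pos h₁, if_neg (fun h => h₂ h.2), counit_box, if_neg h₂, zero_smul, smul_zero]
    · rw [if_neg h₁, if_neg (fun h => h₁ h.1), map_zero, zero_smul, smul_zero]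
  rw [hsum]
  split_ifs with hA
  · have h₀ : T.vB.tgt (T.vB.inv A) = T.vB.src (T.hB.id (T.hB.tgt A)) := by
      rw [T.top_hid, tgt_inv, ← T.corner_rt, hA, tgt_id]
    have hY : T.hB.tgt (T.vB.mul (T.vB.inv A) (T.hB.id (T.hB.tgt A))) =
        T.gV.id (T.gH.tgt (T.vB.tgt A)) := by
      rw [T.tgt_vmul h₀, tgt_id, T.tgt_vinv, GroupoidOn.inv_mul, T.corner_rb]
    have hAY : T.vB.tgt A = T.vB.src (T.vB.mul (T.vB.inv A) (T.hB.id (T.hB.tgt A))) := by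
      rw [src_mul h₀, src_inv]
    have hmul : T.vB.mul A (T.vB.mul (T.vB.inv A) (T.hB.id (T.hB.tgt A))) =
        T.hB.id (T.hB.tgt A) := mul_inv_cancel_left (by rw [← h₀, tgt_inv])
    have hinv : T.hB.inv (T.vB.mul (T.vB.inv A) (T.hB.id (T.hB.tgt A))) = T.sourceBox A := by
      rw [T.hinv_vmul h₀, inv_id, T.hinv_vinv]
      rfl
    have hfac : ∀ {X : B}, T.IsVidFactorization
        (X, T.vB.mul (T.vB.inv A) (T.hB.id (T.hB.tgt A))) →
        X = T.hB.mul (T.vB.id (T.vB.tgt (T.hB.mul X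
          (T.vB.mul (T.vB.inv A) (T.hB.id (T.hB.tgt A)))))) (T.sourceBox A) := by
      intro X h
      rw [T.tgt_hmul h.1, ← h.mul_eq', ← hinv, mul_inv_cancel_right h.1]
    refine Finset.sum_bij' (fun p _ => T.vB.tgt (T.hB.mul p.1 p.2))
      (fun y _ => (T.hB.mul (T.vB.id y) (T.sourceBox A),
        T.vB.mul (T.vB.inv A) (T.hB.id (T.hB.tgt A)))) ?_ ?_ ?_ ?_ ?_
    · rintro ⟨X, Y⟩ hp
      simp only [Finset.mem_filter, Finset.mem_univ, true_and] at hp ⊢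
      obtain ⟨h, h₁, h₂⟩ := hp
      obtain ⟨-, rfl⟩ := h.eq_of_vmul_eq_hid' h₁ h₂
      rw [T.tgt_hmul h.1, tgt_mul (T.tgt_tgt_composable h.1), tgt_mul h₀, T.bot_hid, tgt_id,
        ← T.corner_rb]
      rfl
    · intro y hy
      simp only [Finset.mem_filter, Finset.mem_univ, true_and] at hy ⊢
      have hy' : T.hB.tgt (T.vB.id y) =
          T.hB.tgt (T.vB.mul (T.vB.inv A) (T.hB.id (T.hB.tgt A))) := by
        rw [hY, T.right_vid, hy]
        rfl
      refine ⟨⟨?_, y, ?_⟩, hAY, by rw [hmul, src_id]⟩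
      · rw [← hinv, tgt_mul (by rw [hy', src_inv]), tgt_inv]
      · rw [← hinv, inv_mul_cancel_right hy']
    · rintro ⟨X, Y⟩ hp
      simp only [Finset.mem_filter, Finset.mem_univ, true_and] at hp
      obtain ⟨h, h₁, h₂⟩ := hp
      obtain ⟨-, rfl⟩ := h.eq_of_vmul_eq_hid' h₁ h₂
      simp only [← hfac h]
    · intro y hy
      simp only [Finset.mem_filter, Finset.mem_univ, true_and] at hy
      simp only [← hinv]
      rw [inv_mul_cancel_right, tgt_id]
      rw [hY, T.right_vid, hy]
      rfl
    · rintro ⟨X, Y⟩ hp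
      simp only [Finset.mem_filter, Finset.mem_univ, true_and] at hp
      obtain ⟨h, h₁, h₂⟩ := hp
      obtain ⟨-, rfl⟩ := h.eq_of_vmul_eq_hid' h₁ h₂
      simp only [← hfac h]
  · rw [Finset.filter_false_of_mem, Finset.sum_empty]
    rintro ⟨X, Y⟩ - ⟨h, h₁, h₂⟩
    exact hA (h.eq_of_vmul_eq_hid' h₁ h₂).1

/-- `S(A₁) A₂ S(A₃) = S(A)`: with `A₂ S(A₃)` evaluated first, every factorization `XY = A` in which
`X` has the bottom side of `A` contributes a multiple of `A⁻¹`, and no other does. -/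
theorem mul_map_antipode_box (hϑ : T.IsCornerFunction k ϑ) (A : B) :
    LinearMap.mul' k (T.Alg k ϑ) (TensorProduct.map (T.antipode k ϑ)
      (LinearMap.mul' k (T.Alg k ϑ) ∘ₗ LinearMap.lTensor _ (T.antipode k ϑ))
      (LinearMap.lTensor _ (Coalgebra.comul (R := k))
        (Coalgebra.comul (R := k) (T.box k ϑ A)))) = T.antipode k ϑ (T.box k ϑ A) := by
  classical
  have hterm : ∀ p ∈ T.horFactorizations A,
      LinearMap.mul' k (T.Alg k ϑ) (TensorProduct.map (T.antipode k ϑ)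
        (LinearMap.mul' k (T.Alg k ϑ) ∘ₗ LinearMap.lTensor _ (T.antipode k ϑ))
        (LinearMap.lTensor _ (Coalgebra.comul (R := k))
          ((ϑ (T.lb p.2) : k) • (T.box k ϑ p.1 ⊗ₜ[k] T.box k ϑ p.2)))) =
      if T.vB.tgt p.1 = T.vB.tgt A then
        ((ϑ (T.rt p.1) : k) * ((ϑ (T.rt A) : k) / ϑ (T.rb A))) • T.box k ϑ (T.boxInv A)
      else 0 := by
    rintro ⟨X, Y⟩ hp
    obtain ⟨h, e⟩ := T.mem_horFactorizations_iff.1 hp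
    simp only at h e ⊢
    have hc := T.tgt_tgt_composable h
    have h₁ : T.lb Y = T.rb X := hc.symm
    have h₂ : T.rt Y = T.rt A := by
      simp only [rt, top]; rw [T.corner_rt, T.corner_rt, ← e, tgt_mul h]
    have h₃ : T.rb Y = T.rb A := by
      simp only [rb, bot]; rw [T.corner_rb, T.corner_rb, ← e, tgt_mul h]
    -- `Y` has an identity at the bottom exactly when `X` and `A` have the same bottom side.
    have hiff : T.vB.tgt Y = T.gH.id (T.gH.src (T.vB.tgt Y)) ↔ T.vB.tgt X = T.vB.tgt A := by
      rw [← e, T.tgt_hmul h]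
      constructor
      · intro hY
        rw [hY, mul_id]
        rw [hc]
      · intro hX
        refine mul_left_cancel hc (by rw [src_id, hc]) (?_ : T.gH.mul (T.vB.tgt X) _ = _)
        rw [← hX, mul_id hc]
    rw [map_smul, map_smul, map_smul, LinearMap.lTensor_tmul, TensorProduct.map_tmul,
      LinearMap.mul'_apply, LinearMap.comp_apply, mul_lTensor_antipode_comul_box hϑ, antipode_box]
    simp only [hiff]
    split_ifs with hX
    · have hY := hiff.2 hX
      obtain ⟨e₁, e₂⟩ := vmul_boxInv_targetBox h e hY
      rw [mul_smul_comm, smul_mul_assoc, smul_smul, smul_smul, Finset.mul_sum,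
        Finset.sum_eq_single (T.gH.inv (T.vB.src X)), box_mul, if_pos e₁, e₂, h₁, h₂, h₃]
      · congr 1
        have := (ϑ (T.rb X)).ne_zero
        field_simp
      · -- Only the summand whose top side matches the bottom of `X⁻¹` survives.
        intro x hx hne
        simp only [Finset.mem_filter, Finset.mem_univ, true_and] at hx
        rw [box_mul, if_neg]
        intro hbad
        rw [vsrc_hmul_targetBox_vid hY hx, vtgt_boxInv] at hbad
        exact hne hbad.symm
      · intro hn
        refine absurd ?_ hn
        simp only [Finset.mem_filter, Finset.mem_univ, true_and]
        rw [src_inv]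
        exact T.tgt_src_composable h
    · rw [mul_zero, smul_zero]
  rw [comul_box, map_sum, map_sum, map_sum, Finset.sum_congr rfl hterm,
    sum_horFactorizations_left, ← Finset.sum_filter, Finset.filter_filter, ← Finset.sum_smul,
    ← Finset.sum_mul, antipode_box]
  simp only [and_comm (a := T.hB.src _ = _)]
  rw [hϑ.sum_bot_left, one_mul]
  rw [T.corner_lb]

end Algebra

end DoubleGroupoid

/-! ### Pairings and duals of weak Hopf algebras -/

section Pairing

variable {k H K : Type*} [Field k] [Ring H] [Algebra k H] [Coalgebra k H] [Ring K] [Algebra k K]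
  [Coalgebra k K] {S : H →ₗ[k] H} {S' : K →ₗ[k] K} {β : H →ₗ[k] K →ₗ[k] k}

namespace IsWeakHopfPairing

open Coalgebra

theorem counit_mul_eq_sum (hβ : IsWeakHopfPairing k S S' β) {ι : Type*}
    (r : Coalgebra.Repr k (1 : K) ι) (a b : H) :
    counit (R := k) (a * b) = ∑ i ∈ r.index, β a (r.left i) * β b (r.right i) := by
  rw [← hβ.one_right, hβ.mul_left, ← r.eq]
  simp

theorem apply_mul_eq_sum (hβ : IsWeakHopfPairing k S S' β) {ι : Type*} {a : H}
    (r : Coalgebra.Repr k a ι) (x y : K) :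
    β a (x * y) = ∑ i ∈ r.index, β (r.left i) x * β (r.right i) y := by
  rw [hβ.mul_right, ← r.eq]
  simp

/-- `ε(abc) = (a ⊗ b ⊗ c, Δ²(1))`. -/
theorem counit_mul_mul_eq (hβ : IsWeakHopfPairing k S S' β) (a b c : H) :
    counit (R := k) (a * b * c) =
      LinearMap.mul' k k (TensorProduct.map (β a) (LinearMap.mul' k k ∘ₗ
        TensorProduct.map (β b) (β c)) (LinearMap.lTensor K (comul (R := k))
          (comul (R := k) (1 : K)))) := by
  rw [mul_assoc, ← hβ.one_right, hβ.mul_left]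
  have : β (b * c) = (LinearMap.mul' k k ∘ₗ TensorProduct.map (β b) (β c)) ∘ₗ comul (R := k) :=
    LinearMap.ext fun x => hβ.mul_left b c x
  rw [this, ← LinearMap.map_comp_lTensor]
  rfl

/-- Under a pairing, the axiom on `Δ²(1)` in one algebra gives the corresponding axiom on
`ε(abc)` in the other. -/
theorem counit_mul_mul (hβ : IsWeakHopfPairing k S S' β)
    (h : LinearMap.lTensor K (comul (R := k)) (comul (R := k) (1 : K)) =
      TensorProduct.assoc k K K K (comul (R := k) (1 : K) ⊗ₜ[k] (1 : K)) *
        ((1 : K) ⊗ₜ[k] comul (R := k) (1 : K))) (a b c : H) :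
    counit (R := k) (a * b * c) =
      LinearMap.mul' k k (TensorProduct.map (counit (R := k) ∘ₗ LinearMap.mulLeft k a)
        (counit (R := k) ∘ₗ LinearMap.mulRight k c) (comul (R := k) b)) := by
  rw [hβ.counit_mul_mul_eq, h]
  conv_lhs => rw [← (ℛ k (1 : K)).eq]
  conv_rhs => rw [← (ℛ k b).eq]
  simp only [TensorProduct.sum_tmul, TensorProduct.tmul_sum, map_sum, TensorProduct.assoc_tmul,
    Algebra.TensorProduct.tmul_mul_tmul, one_mul, mul_one,
    TensorProduct.map_tmul, LinearMap.mul'_apply, LinearMap.comp_apply, LinearMap.mulLeft_apply,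
    LinearMap.mulRight_apply, hβ.apply_mul_eq_sum (ℛ k b), hβ.counit_mul_eq_sum (ℛ k (1 : K)),
    Finset.sum_mul, Finset.mul_sum]
  rw [Finset.sum_comm_cycle]
  simp only [mul_assoc]

/-- The variant of `IsWeakHopfPairing.counit_mul_mul` for the opposite order of factors. -/
theorem counit_mul_mul' (hβ : IsWeakHopfPairing k S S' β)
    (h : LinearMap.lTensor K (comul (R := k)) (comul (R := k) (1 : K)) =
      ((1 : K) ⊗ₜ[k] comul (R := k) (1 : K)) *
        TensorProduct.assoc k K K K (comul (R := k) (1 : K) ⊗ₜ[k] (1 : K))) (a b c : H) :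
    counit (R := k) (a * b * c) =
      LinearMap.mul' k k (TensorProduct.map (counit (R := k) ∘ₗ LinearMap.mulLeft k a)
        (counit (R := k) ∘ₗ LinearMap.mulRight k c)
        (TensorProduct.comm k H H (comul (R := k) b))) := by
  rw [hβ.counit_mul_mul_eq, h]
  conv_lhs => rw [← (ℛ k (1 : K)).eq]
  conv_rhs => rw [← (ℛ k b).eq]
  simp only [TensorProduct.sum_tmul, TensorProduct.tmul_sum, map_sum, TensorProduct.assoc_tmul,
    Algebra.TensorProduct.tmul_mul_tmul, one_mul, mul_one, TensorProduct.comm_tmul,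
    TensorProduct.map_tmul, LinearMap.mul'_apply, LinearMap.comp_apply, LinearMap.mulLeft_apply,
    LinearMap.mulRight_apply, hβ.apply_mul_eq_sum (ℛ k b), hβ.counit_mul_eq_sum (ℛ k (1 : K)),
    Finset.sum_mul, Finset.mul_sum]
  rw [Finset.sum_comm_cycle]
  refine Finset.sum_congr rfl fun l _ => ?_
  rw [Finset.sum_comm]
  simp only [mul_assoc, mul_left_comm]

end IsWeakHopfPairing

/-- The algebra `K` of a nondegenerate weak Hopf pairing is the dual of `H`. -/
noncomputable def IsWeakHopfPairing.equivDual [Module.Finite k H]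
    (hβ : IsWeakHopfPairing k S S' β) [β.IsPerfPair] : K ≃ₐc[k] DualAlg k H where
  __ := β.flip.toPerfPair.trans (WithConv.linearEquiv k (Module.Dual k H)).symm
  counit_comp := LinearMap.ext fun x => hβ.one_left x
  map_comp_comul := by
    refine LinearMap.ext fun x => (dualTensorEquiv k H).injective <|
      TensorProduct.ext' fun a b => ?_
    refine Eq.trans ?_ (dualTensorEquiv_dualComul k H _ a b).symm
    refine Eq.trans ?_ (hβ.mul_left a b x).symm
    rw [LinearMap.comp_apply]
    generalize Coalgebra.comul (R := k) x = u
    induction u with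
    | zero => simp
    | add x y hx hy => simp only [map_add, LinearMap.add_apply, hx, hy]
    | tmul x y => rw [TensorProduct.map_tmul, dualTensorEquiv_tmul]; rfl
  map_mul' x y := WithConv.ext <| LinearMap.ext fun a => hβ.mul_right a x y

theorem IsWeakHopfPairing.equivDual_apply [Module.Finite k H]
    (hβ : IsWeakHopfPairing k S S' β) [β.IsPerfPair] (x : K) (a : H) :
    hβ.equivDual x a = β a x := rfl

end Pairing

section Transport

variable {k A K : Type*} [Field k] [Ring A] [Algebra k A] [Coalgebra k A] [Ring K] [Algebra k K]
  [Coalgebra k K] {S : A →ₗ[k] A} {S' : K →ₗ[k] K}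

open Coalgebra in
/-- The axioms of a weak Hopf algebra are transported along isomorphisms. -/
theorem IsWeakHopfAlgebra.of_equiv (hK : IsWeakHopfAlgebra k S') (φ : K ≃ₐc[k] A)
    (hS : ∀ x, S (φ x) = φ (S' x)) : IsWeakHopfAlgebra k S := by
  let f : K →ₐ[k] A := (φ : K →ₐc[k] A)
  have hf : ∀ x, φ x = f x := fun x => rfl
  let f₂ := Algebra.TensorProduct.map f f
  let f₃ := Algebra.TensorProduct.map f f₂
  have hsurj : ∀ a, ∃ x, f x = a := φ.surjective
  have hcomul : ∀ x, comul (R := k) (f x) = f₂ (comul (R := k) x) := fun x =>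
    (CoalgHomClass.map_comp_comul_apply φ x).symm
  have hcounit : ∀ x, counit (R := k) (f x) = counit (R := k) x := fun x =>
    CoalgHomClass.counit_comp_apply φ x
  have h₁ : f₂ (comul (R := k) 1) = comul (R := k) (1 : A) := by rw [← hcomul, map_one]
  have hl : ∀ u, LinearMap.lTensor A (comul (R := k)) (f₂ u) =
      f₃ (LinearMap.lTensor K (comul (R := k)) u) := by
    intro u
    induction u with
    | zero => simp
    | add x y hx hy => simp only [map_add, hx, hy]
    | tmul x y => simp [f₂, f₃, hcomul]
  have ha : ∀ u, TensorProduct.assoc k A A A (f₂ u ⊗ₜ[k] 1) =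
      f₃ (TensorProduct.assoc k K K K (u ⊗ₜ[k] 1)) := by
    intro u
    induction u with
    | zero => simp
    | add x y hx hy => simp only [map_add, TensorProduct.add_tmul, hx, hy]
    | tmul x y => simp [f₂, f₃]
  have hb : ∀ u, (1 : A) ⊗ₜ[k] f₂ u = f₃ (1 ⊗ₜ[k] u) := fun u => by simp [f₃]
  have hc : ∀ u, TensorProduct.comm k A A (f₂ u) = f₂ (TensorProduct.comm k K K u) := by
    intro u
    induction u with
    | zero => simp
    | add x y hx hy => simp only [map_add, hx, hy]
    | tmul x y => simp [f₂]
  have hε : ∀ a c u, LinearMap.mul' k k (TensorProduct.map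
      (counit (R := k) ∘ₗ LinearMap.mulLeft k (f a))
      (counit (R := k) ∘ₗ LinearMap.mulRight k (f c)) (f₂ u)) =
      LinearMap.mul' k k (TensorProduct.map
      (counit (R := k) ∘ₗ LinearMap.mulLeft k a)
      (counit (R := k) ∘ₗ LinearMap.mulRight k c) u) := by
    intro a c u
    induction u with
    | zero => simp
    | add x y hx hy => simp only [map_add, hx, hy]
    | tmul x y => simp [f₂, ← map_mul, hcounit]
  have hml : ∀ u, LinearMap.mul' k A (LinearMap.lTensor A S (f₂ u)) =
      f (LinearMap.mul' k K (LinearMap.lTensor K S' u)) := by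
    intro u
    induction u with
    | zero => simp
    | add x y hx hy => simp only [map_add, hx, hy]
    | tmul x y => simp [f₂, ← hf, hS]
  have hmr : ∀ u, LinearMap.mul' k A (LinearMap.rTensor A S (f₂ u)) =
      f (LinearMap.mul' k K (LinearMap.rTensor K S' u)) := by
    intro u
    induction u with
    | zero => simp
    | add x y hx hy => simp only [map_add, hx, hy]
    | tmul x y => simp [f₂, ← hf, hS]
  have hm : ∀ u, LinearMap.mul' k A (TensorProduct.map S
        (LinearMap.mul' k A ∘ₗ LinearMap.lTensor A S) (f₃ u)) =
      f (LinearMap.mul' k K (TensorProduct.map S'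
        (LinearMap.mul' k K ∘ₗ LinearMap.lTensor K S') u)) := by
    intro u
    induction u with
    | zero => simp
    | add x y hx hy => simp only [map_add, hx, hy]
    | tmul x y => simp [f₃, ← hf, hS]; simp [hf, hml]
  have ht : ∀ x, weakTarget k (f x) = f (weakTarget k x) := by
    intro x
    have : comul (R := k) (1 : A) * (f x ⊗ₜ[k] 1) = f₂ (comul (R := k) 1 * (x ⊗ₜ[k] 1)) := by
      rw [map_mul, h₁]; simp [f₂]
    rw [weakTarget, this, weakTarget]
    generalize comul (R := k) (1 : K) * (x ⊗ₜ[k] 1) = u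
    induction u with
    | zero => simp
    | add x y hx hy => simp only [map_add, hx, hy]
    | tmul x y => simp [f₂, hcounit]
  have hs : ∀ x, weakSource k (f x) = f (weakSource k x) := by
    intro x
    have : (1 ⊗ₜ[k] f x) * comul (R := k) (1 : A) = f₂ ((1 ⊗ₜ[k] x) * comul (R := k) 1) := by
      rw [map_mul, h₁]; simp [f₂]
    rw [weakSource, this, weakSource]
    generalize (1 ⊗ₜ[k] x) * comul (R := k) (1 : K) = u
    induction u with
    | zero => simp
    | add x y hx hy => simp only [map_add, hx, hy]
    | tmul x y => simp [f₂, hcounit]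
  constructor
  · constructor
    · intro a b
      obtain ⟨x, rfl⟩ := hsurj a
      obtain ⟨y, rfl⟩ := hsurj b
      rw [← map_mul, hcomul, hK.comul_mul, map_mul, hcomul, hcomul]
    · rw [← h₁, hl, ha, hb, hK.comul_comul_one, map_mul]
    · rw [← h₁, hl, ha, hb, hK.comul_comul_one', map_mul]
    · intro a b c
      obtain ⟨x, rfl⟩ := hsurj a
      obtain ⟨y, rfl⟩ := hsurj b
      obtain ⟨z, rfl⟩ := hsurj c
      rw [hcomul, hε, ← hK.counit_mul_mul, ← map_mul, ← map_mul, hcounit]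
    · intro a b c
      obtain ⟨x, rfl⟩ := hsurj a
      obtain ⟨y, rfl⟩ := hsurj b
      obtain ⟨z, rfl⟩ := hsurj c
      rw [hcomul, hc, hε, ← hK.counit_mul_mul', ← map_mul, ← map_mul, hcounit]
  · intro a
    obtain ⟨x, rfl⟩ := hsurj a
    rw [hcomul, hml, ht, hK.mul_id_antipode]
  · intro a
    obtain ⟨x, rfl⟩ := hsurj a
    rw [hcomul, hmr, hs, hK.mul_antipode_id]
  · intro a
    obtain ⟨x, rfl⟩ := hsurj a
    rw [hcomul, hl, hm, hK.mul_antipode_id_antipode, ← hf, ← hf, hS]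

end Transport

/-! ### The pairing of a double groupoid with its transpose -/

namespace DoubleGroupoid

open GroupoidOn

variable {B H V P k : Type*} [Field k] (T : DoubleGroupoid B H V P) (ϑ : P → kˣ)

/-- The value `ϑ(lt(A)) / (ϑ(rt(A)) ϑ(lb(A)))` of the pairing on a box `A` and its transpose. -/
noncomputable def pairingCoeff (A : B) : k :=
  (ϑ (T.lt A) : k) / (ϑ (T.rt A) * ϑ (T.lb A))

/-- The pairing of `k^(ϑ) T` and `k^(ϑ) Tᵗ`, in terms of the unscaled boxes: a box is orthogonal
to all boxes of the transpose but its own transpose. -/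
noncomputable def pairing : T.Alg k ϑ →ₗ[k] T.transpose.Alg k ϑ →ₗ[k] k :=
  (T.box k ϑ).constr k fun A => T.pairingCoeff ϑ A • (T.transpose.box k ϑ).coord A

variable {T ϑ}

theorem pairingCoeff_ne_zero (A : B) : T.pairingCoeff ϑ A ≠ 0 :=
  div_ne_zero (ϑ _).ne_zero (mul_ne_zero (ϑ _).ne_zero (ϑ _).ne_zero)

open Classical in
theorem pairing_box_box (A C : B) :
    T.pairing ϑ (T.box k ϑ A) (T.transpose.box k ϑ C) =
      if A = C then T.pairingCoeff ϑ A else 0 := by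
  rw [pairing, Module.Basis.constr_basis, LinearMap.smul_apply, Module.Basis.coord_apply,
    Module.Basis.repr_self, Finsupp.single_apply]
  simp [eq_comm]

theorem pairing_box_apply (A : B) (x : T.transpose.Alg k ϑ) :
    T.pairing ϑ (T.box k ϑ A) x = T.pairingCoeff ϑ A * (T.transpose.box k ϑ).repr x A := by
  rw [pairing, Module.Basis.constr_basis, LinearMap.smul_apply, Module.Basis.coord_apply,
    smul_eq_mul]

theorem pairing_apply_box (a : T.Alg k ϑ) (C : B) :
    T.pairing ϑ a (T.transpose.box k ϑ C) = T.pairingCoeff ϑ C * (T.box k ϑ).repr a C := by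
  classical
  induction a using Alg.induction with
  | box A =>
    rw [pairing_box_box, Module.Basis.repr_self, Finsupp.single_apply]
    split_ifs with h
    · rw [h, mul_one]
    · rw [mul_zero]
  | zero => simp
  | add a b ha hb => simp only [map_add, LinearMap.add_apply, ha, hb, Finsupp.add_apply, mul_add]
  | smul c a ha =>
    simp only [map_smul, LinearMap.smul_apply, ha, Finsupp.smul_apply, smul_eq_mul]
    ring

theorem pairing_nondegenerate : (T.pairing (k := k) ϑ).Nondegenerate := by
  constructor
  · intro a ha
    refine (T.box k ϑ).repr.injective (Finsupp.ext fun C => ?_)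
    have := ha (T.transpose.box k ϑ C)
    rw [pairing_apply_box] at this
    simpa [pairingCoeff_ne_zero] using this
  · intro x hx
    refine (T.transpose.box k ϑ).repr.injective (Finsupp.ext fun A => ?_)
    have := hx (T.box k ϑ A)
    rw [pairing_box_apply] at this
    simpa [pairingCoeff_ne_zero] using this

/-- The value of `(S(A), B)` at the box `B = A⁻¹`. -/
theorem mul_antipodeCoeff (A : B) :
    (ϑ (T.rt A) : k) / ϑ (T.rb A) * T.pairingCoeff ϑ (T.boxInv A) = (ϑ (T.lb A) : k)⁻¹ := by
  have h₁ := (ϑ (T.rt A)).ne_zero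
  have h₂ := (ϑ (T.rb A)).ne_zero
  simp only [pairingCoeff, boxInv, lt_vinv, rt_vinv, lb_vinv, lb_hinv, rb_hinv, lt_hinv]
  field_simp

/-- The value of `(B, S(A))` at the box `B = A⁻¹`, for the antipode of the transpose. -/
theorem mul_antipodeCoeff_transpose (A : B) :
    (ϑ (T.transpose.rt A) : k) / ϑ (T.transpose.rb A) * T.pairingCoeff ϑ (T.boxInv A) =
      (ϑ (T.rt A) : k)⁻¹ := by
  have h₁ := (ϑ (T.lb A)).ne_zero
  have h₂ := (ϑ (T.rb A)).ne_zero
  simp only [transpose_rt, transpose_rb, pairingCoeff, boxInv, lt_vinv, rt_vinv, lb_vinv, lb_hinv,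
    rb_hinv, lt_hinv]
  field_simp

theorem boxInv_boxInv (A : B) : T.boxInv (T.boxInv A) = A := by
  rw [boxInv, hinv_boxInv, GroupoidOn.inv_inv]

theorem transpose_boxInv (A : B) : T.transpose.boxInv A = T.boxInv A := T.hinv_vinv A

theorem pairing_box_mul_box_left [Fintype B] [Fintype H] [Fintype V] (A C X : B) :
    T.pairing ϑ (T.box k ϑ A * T.box k ϑ C) (T.transpose.box k ϑ X) =
    LinearMap.mul' k k (TensorProduct.map (T.pairing ϑ (T.box k ϑ A))
      (T.pairing ϑ (T.box k ϑ C)) (Coalgebra.comul (R := k) (T.transpose.box k ϑ X))) := by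
  classical
  rw [comul_box, map_sum, map_sum]
  simp only [map_smul, TensorProduct.map_tmul, LinearMap.mul'_apply, pairing_box_box,
    smul_eq_mul]
  by_cases hX : (A, C) ∈ T.transpose.horFactorizations X
  · rw [Finset.sum_eq_single (A, C)]
    · obtain ⟨h, e⟩ := T.transpose.mem_horFactorizations_iff.1 hX
      have h' : T.vB.tgt A = T.vB.src C := h
      have e' : T.vB.mul A C = X := e
      rw [box_mul, if_pos h', pairing_box_box, if_pos e', if_pos rfl, if_pos rfl]
      have e₁ : T.lb A = T.lt C := by simp only [lb, lt, bot, top, h']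
      have e₂ : T.lt (T.vB.mul A C) = T.lt A := by simp only [lt, top, src_mul h']
      have e₃ : T.rt (T.vB.mul A C) = T.rt A := by simp only [rt, top, src_mul h']
      have e₄ : T.lb (T.vB.mul A C) = T.lb C := by simp only [lb, bot, tgt_mul h']
      simp only [pairingCoeff, transpose_lb, e₁, e₂, e₃, e₄]
      have := (ϑ (T.rt C)).ne_zero
      have := (ϑ (T.lt C)).ne_zero
      field_simp
    · rintro ⟨Y, Z⟩ - hYZ
      by_cases hY : A = Y
      · have hZ : C ≠ Z := fun hZ => hYZ (by rw [hY, hZ])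
        rw [if_neg hZ, mul_zero, mul_zero]
      · rw [if_neg hY, zero_mul, mul_zero]
    · exact fun hn => absurd hX hn
  · rw [Finset.sum_eq_zero, box_mul]
    · split_ifs with h
      · rw [pairing_box_box, if_neg]
        exact fun e => hX (T.transpose.mem_horFactorizations_iff.2 ⟨h, e⟩)
      · simp
    · rintro ⟨Y, Z⟩ hYZ
      by_cases hY : A = Y
      · have hZ : C ≠ Z := fun hZ => hX (by rw [hY, hZ]; exact hYZ)
        rw [if_neg hZ, mul_zero, mul_zero]
      · rw [if_neg hY, zero_mul, mul_zero]

theorem pairing_box_mul_box_right [Fintype B] [Fintype H] [Fintype V] (A C X : B) :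
    T.pairing ϑ (T.box k ϑ X)
    (T.transpose.box k ϑ A * T.transpose.box k ϑ C) =
    LinearMap.mul' k k (TensorProduct.map ((T.pairing ϑ).flip (T.transpose.box k ϑ A))
      ((T.pairing ϑ).flip (T.transpose.box k ϑ C))
      (Coalgebra.comul (R := k) (T.box k ϑ X))) := by
  classical
  rw [comul_box, map_sum, map_sum]
  simp only [map_smul, TensorProduct.map_tmul, LinearMap.mul'_apply, LinearMap.flip_apply,
    pairing_box_box, smul_eq_mul]
  by_cases hX : (A, C) ∈ T.horFactorizations X
  · rw [Finset.sum_eq_single (A, C)]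
    · obtain ⟨h, e⟩ := T.mem_horFactorizations_iff.1 hX
      have h' : T.transpose.vB.tgt A = T.transpose.vB.src C := h
      have e' : X = T.transpose.vB.mul A C := e.symm
      rw [box_mul, if_pos h', pairing_box_box, if_pos e', if_pos rfl, if_pos rfl]
      have e₁ : T.rt A = T.lt C := T.tgt_src_composable h
      have e₂ : T.lt X = T.lt A := by
        simp only [lt, top]
        rw [T.corner_lt, T.corner_lt, ← e, src_mul h]
      have e₃ : T.lb X = T.lb A := by
        simp only [lb, bot]
        rw [T.corner_lb, T.corner_lb, ← e, src_mul h]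
      have e₄ : T.rt X = T.rt C := by
        simp only [rt, top]
        rw [T.corner_rt, T.corner_rt, ← e, tgt_mul h]
      simp only [pairingCoeff, e₁, e₂, e₃, e₄]
      have := (ϑ (T.lb C)).ne_zero
      have := (ϑ (T.lt C)).ne_zero
      field_simp
    · rintro ⟨Y, Z⟩ - hYZ
      by_cases hY : Y = A
      · have hZ : Z ≠ C := fun hZ => hYZ (by rw [hY, hZ])
        rw [if_neg hZ, mul_zero, mul_zero]
      · rw [if_neg hY, zero_mul, mul_zero]
    · exact fun hn => absurd hX hn
  · rw [Finset.sum_eq_zero, box_mul]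
    · split_ifs with h
      · rw [pairing_box_box, if_neg]
        exact fun e => hX (T.mem_horFactorizations_iff.2 ⟨h, e.symm⟩)
      · simp
    · rintro ⟨Y, Z⟩ hYZ
      by_cases hY : Y = A
      · have hZ : Z ≠ C := fun hZ => hX (by rw [← hY, ← hZ]; exact hYZ)
        rw [if_neg hZ, mul_zero, mul_zero]
      · rw [if_neg hY, zero_mul, mul_zero]

theorem pairing_isWeakHopfPairing [Fintype B] [Fintype H] [Fintype V] :
    IsWeakHopfPairing k (T.antipode k ϑ) (T.transpose.antipode k ϑ) (T.pairing ϑ) := by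
  classical
  have hne : ∀ p, (ϑ p : k) ≠ 0 := fun p => (ϑ p).ne_zero
  constructor
  · intro a b x
    induction a using Alg.induction with
    | box A =>
      induction b using Alg.induction with
      | box C =>
        induction x using Alg.induction with
        | box X => exact pairing_box_mul_box_left A C X
        | zero => simp
        | add x y hx hy => simp only [map_add, hx, hy]
        | smul c x hx => simp only [map_smul, hx]
      | zero => simp
      | add b c hb hc =>
        simp only [mul_add, map_add, LinearMap.add_apply, TensorProduct.map_add_right, hb, hc]
      | smul c b hb =>
        simp only [mul_smul_comm, map_smul, LinearMap.smul_apply, TensorProduct.map_smul_right, hb]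
    | zero => simp
    | add a c ha hc =>
      simp only [add_mul, map_add, LinearMap.add_apply, TensorProduct.map_add_left, ha, hc]
    | smul c a ha =>
      simp only [smul_mul_assoc, map_smul, LinearMap.smul_apply, TensorProduct.map_smul_left, ha]
  · intro a x y
    induction x using Alg.induction with
    | box A =>
      induction y using Alg.induction with
      | box C =>
        induction a using Alg.induction with
        | box X => exact pairing_box_mul_box_right A C X
        | zero => simp
        | add x y hx hy => simp only [map_add, LinearMap.add_apply, hx, hy]
        | smul c x hx => simp only [map_smul, LinearMap.smul_apply, hx]
      | zero => simp
      | add b c hb hc => simp only [mul_add, map_add, TensorProduct.map_add_right,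
          LinearMap.add_apply, hb, hc]
      | smul c b hb => simp only [mul_smul_comm, map_smul, TensorProduct.map_smul_right,
          LinearMap.smul_apply, hb]
    | zero => simp
    | add a c ha hc => simp only [add_mul, map_add, TensorProduct.map_add_left,
          LinearMap.add_apply, ha, hc]
    | smul c a ha => simp only [smul_mul_assoc, map_smul, TensorProduct.map_smul_left,
          LinearMap.smul_apply, ha]
  · intro x
    induction x using Alg.induction with
    | box X =>
      rw [one_def, map_sum, LinearMap.sum_apply, counit_box]
      simp only [pairing_box_box]
      by_cases hX : X = T.vB.id (T.vB.src X)
      · rw [Finset.sum_eq_single (T.vB.src X), if_pos hX.symm, ← hX]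
        · refine Eq.trans ?_ (if_pos hX).symm
          have e : T.lt X = T.lb X := by
            simp only [lt, lb, top, bot]
            conv_rhs => rw [hX]
            rw [tgt_id]
          rw [pairingCoeff, transpose_lb, e]
          have := hne (T.lb X)
          field_simp
        · rintro x - hx
          rw [if_neg]
          rintro rfl
          exact hx (src_id _ _).symm
        · simp
      · refine Eq.trans (Finset.sum_eq_zero fun x _ => ?_) (if_neg hX).symm
        rw [if_neg]
        rintro rfl
        rw [src_id] at hX
        exact hX rfl
    | zero => simp
    | add x y hx hy => simp only [map_add, hx, hy]
    | smul c x hx => simp only [map_smul, hx]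
  · intro a
    induction a using Alg.induction with
    | box A =>
      rw [one_def, map_sum, counit_box]
      simp only [pairing_box_box]
      by_cases hA : A = T.hB.id (T.hB.src A)
      · rw [Finset.sum_eq_single (T.hB.src A), if_pos hA]
        · refine (if_pos hA).trans ?_
          have e : T.lt A = T.rt A := by
            simp only [lt, rt, top]
            rw [T.corner_lt, T.corner_rt]
            conv_rhs => rw [hA, tgt_id]
          rw [pairingCoeff, e]
          have := hne (T.rt A)
          field_simp
        · rintro g - hg
          rw [if_neg]
          rintro rfl
          exact hg (T.hB.src_id g).symm
        · simp
      · rw [if_neg hA]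
        refine Finset.sum_eq_zero fun g _ => ?_
        rw [if_neg]
        rintro rfl
        exact hA (congrArg T.hB.id (T.hB.src_id g)).symm
    | zero => simp
    | add x y hx hy => simp only [map_add, LinearMap.add_apply, hx, hy]
    | smul c x hx => simp only [map_smul, LinearMap.smul_apply, hx]
  · intro a x
    induction a using Alg.induction with
    | box A =>
      induction x using Alg.induction with
      | box X =>
        rw [antipode_box, antipode_box, map_smul, map_smul, LinearMap.smul_apply, pairing_box_box,
          transpose_boxInv, pairing_box_box, smul_eq_mul, smul_eq_mul]
        by_cases h : T.boxInv A = X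
        · have h' : A = T.boxInv X := by rw [← h, boxInv_boxInv]
          rw [if_pos h, if_pos h', mul_antipodeCoeff, h', mul_antipodeCoeff_transpose]
          simp only [boxInv, lb_vinv, lt_hinv]
        · have h' : A ≠ T.boxInv X := fun e => h (by rw [e, boxInv_boxInv])
          rw [if_neg h, if_neg h', mul_zero, mul_zero]
      | zero => simp
      | add x y hx hy => simp only [map_add, hx, hy]
      | smul c x hx => simp only [map_smul, hx]
    | zero => simp
    | add x y hx hy => simp only [map_add, LinearMap.add_apply, hx, hy]
    | smul c x hx => simp only [map_smul, LinearMap.smul_apply, hx]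

/-- The axioms on `Δ` and on the antipode are checked on boxes; those on `ε(abc)` are adjoint to
the axioms on `Δ²(1)` in the transpose, which hold without any condition on `ϑ`. -/
theorem isWeakHopfAlgebra [Fintype B] [Fintype H] [Fintype V] (hϑ : T.IsCornerFunction k ϑ) :
    IsWeakHopfAlgebra k (T.antipode k ϑ) := by
  have hβ := pairing_isWeakHopfPairing (T := T) (ϑ := ϑ)
  constructor
  · constructor
    · intro a b
      induction a using Alg.induction with
      | box A =>
        induction b using Alg.induction with
        | box C => exact T.comul_mul_box ϑ hϑ A C
        | zero => simp
        | add b c hb hc => simp only [mul_add, map_add, hb, hc]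
        | smul c b hb => simp only [mul_smul_comm, map_smul, hb]
      | zero => simp
      | add a c ha hc => simp only [add_mul, map_add, ha, hc]
      | smul c a ha => simp only [smul_mul_assoc, map_smul, ha]
    · exact comul_comul_one_eq_below ϑ
    · exact comul_comul_one_eq_above ϑ
    · exact hβ.counit_mul_mul (comul_comul_one_eq_below ϑ)
    · exact hβ.counit_mul_mul' (comul_comul_one_eq_above ϑ)
  · intro a
    induction a using Alg.induction with
    | box A => rw [mul_lTensor_antipode_comul_box hϑ, weakTarget_box]
    | zero => simp [weakTarget]
    | add a b ha hb =>
      simp only [weakTarget, map_add, TensorProduct.add_tmul, mul_add] at ha hb ⊢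
      rw [ha, hb]
    | smul c a ha =>
      simp only [weakTarget, map_smul, ← TensorProduct.smul_tmul', mul_smul_comm] at ha ⊢
      rw [ha]
  · intro a
    induction a using Alg.induction with
    | box A => rw [mul_rTensor_antipode_comul_box hϑ, weakSource_box]
    | zero => simp [weakSource]
    | add a b ha hb =>
      simp only [weakSource, map_add, TensorProduct.tmul_add, add_mul] at ha hb ⊢
      rw [ha, hb]
    | smul c a ha =>
      simp only [weakSource, map_smul, TensorProduct.tmul_smul, smul_mul_assoc] at ha ⊢
      rw [ha]
  · intro a
    induction a using Alg.induction with
    | box A => exact mul_map_antipode_box hϑ A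
    | zero => simp
    | add a b ha hb => simp only [map_add, ha, hb]
    | smul c a ha => simp only [map_smul, ha]

end DoubleGroupoid

theorem mainTheorem11 {B H V P k : Type*} [Fintype B] [Fintype H] [Fintype V]
    [DecidableEq B] [Field k] [CharZero k] (T : DoubleGroupoid B H V P) (ϑ : P → kˣ)
    (hϑ : T.IsCornerFunction k ϑ) :
    IsWeakHopfAlgebra k (T.antipode k ϑ) ∧
    IsWeakHopfAlgebra k (T.transpose.antipode k ϑ) ∧
    IsWeakHopfAlgebra k (dualAntipode (T.antipode k ϑ)) ∧
    ∃ β : T.Alg k ϑ →ₗ[k] T.transpose.Alg k ϑ →ₗ[k] k,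
      (∀ A C : B, β (T.rbox k ϑ A) (T.transpose.box k ϑ C) = if A = C then T.mu k ϑ A else 0) ∧
      β.Nondegenerate ∧
      IsWeakHopfPairing k (T.antipode k ϑ) (T.transpose.antipode k ϑ) β ∧
      ∃ e : DualAlg k (T.Alg k ϑ) ≃ₐc[k] T.transpose.Alg k ϑ,
        (∀ f, e (dualAntipode (T.antipode k ϑ) f) = T.transpose.antipode k ϑ (e f)) ∧
        ∀ f a, f a = β a (e f) := by
  have hT' := DoubleGroupoid.isWeakHopfAlgebra hϑ.transpose
  have hβ := DoubleGroupoid.pairing_isWeakHopfPairing (T := T) (ϑ := ϑ)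
  have hN := DoubleGroupoid.pairing_nondegenerate (T := T) (ϑ := ϑ)
  have : (T.pairing ϑ).IsPerfPair := .of_injective
    (LinearMap.separatingLeft_iff_ker_eq_bot.1 hN.1 |> LinearMap.ker_eq_bot.1)
    (LinearMap.separatingRight_iff_flip_ker_eq_bot.1 hN.2 |> LinearMap.ker_eq_bot.1)
  have hS : ∀ x, dualAntipode (T.antipode k ϑ) (hβ.equivDual x) =
      hβ.equivDual (T.transpose.antipode k ϑ x) := fun x =>
    WithConv.ext <| LinearMap.ext fun a => hβ.antipode a x
  refine ⟨DoubleGroupoid.isWeakHopfAlgebra hϑ, hT', hT'.of_equiv hβ.equivDual hS, T.pairing ϑ,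
    ?_, hN, hβ, hβ.equivDual.symm, ?_, ?_⟩
  · intro A C
    rw [DoubleGroupoid.rbox, map_smul, LinearMap.smul_apply, DoubleGroupoid.pairing_box_box,
      smul_eq_mul, DoubleGroupoid.pairingCoeff, DoubleGroupoid.mu]
    have := (ϑ (T.lb A)).ne_zero
    split_ifs
    · field_simp
    · rw [mul_zero]
  · intro f
    obtain ⟨x, rfl⟩ : ∃ x, hβ.equivDual x = f := hβ.equivDual.surjective f
    rw [hS, BialgEquiv.symm_apply_apply, BialgEquiv.symm_apply_apply]
  · intro f a
    obtain ⟨x, rfl⟩ : ∃ x, hβ.equivDual x = f := hβ.equivDual.surjective f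
    rw [BialgEquiv.symm_apply_apply, hβ.equivDual_apply]
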